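/- **Conventions.** Let $\mathbb H$ be the complex upper half plane and $\Gamma(N)\subseteq SL_2(\mathbb Z)$, $N\ge 1$, the principal congruence subgroup of level $N$. For $k\in\mathbb Z$, $f:\mathbb H\to\mathbb C$ and $\alpha=\begin{pmatrix}a&b\\c&d\end{pmatrix}\in GL_2^+(\mathbb Q)$ put $(f|_k\alpha)(z)=(cz+d)^{-k}f\left(\frac{az+b}{cz+d}\right)$. Let $\mathcal M_k(\Gamma(N))$ be the space of modular forms of weight $k$ and level $\Gamma(N)$ (holomorphic at the cusps). A holomorphic function $f:\mathbb H\to\mathbb C$ is a quasimodular form of weight $k\ge 0$ and level $N$ if there are holomorphic functions $f_0,\dots,f_s:\mathbb H\to\mathbb C$ with $$(f|_k\gamma)(z)=\sum_{j=0}^s f_j(z)\left(\frac{c}{cz+d}\right)^j\qquad\text{for all }\gamma=\begin{pmatrix}a&b\\c&d\end{pmatrix}\in\Gamma(N),$$ and such that each $f_j|_{k-2j}\delta$ with $\delta\in SL_2(\mathbb Z)$ is bounded as $\mathrm{Im}(z)\to\infty$. Let $\mathcal M$ (the modular tower) and $\mathcal{QM}$ (the quasimodular tower) be the direct sums over the weights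 $k\ge 0$ of the spaces of modular, respectively quasimodular, forms of weight $k$ and arbitrary level $N\geq 1$ (and arbitrary depth). Let $G_K(z)=-\frac{B_K}{2K}+\sum_{n\ge1}\Big(\sum_{d|n}d^{K-1}\Big)e^{2\pi inz}$. Every $f\in\mathcal{QM}$ is uniquely a finite sum $f=\sum_i a_i(f)G_2^i$ with $a_i(f)\in\mathcal M$. For $\alpha\in GL_2^+(\mathbb Q)$ let $g\mapsto g|\alpha$ be the map on $\mathcal M$ that equals $g\mapsto g|_k\alpha$ in weight $k$, and put $f||\alpha=\sum_i(a_i(f)|\alpha)\,G_2^i$ for $f\in\mathcal{QM}$. **The algebra.** Let $\Gamma=\Gamma(N)$. Let $\mathcal Q(\Gamma)$ be the complex vector space of functions $F:\Gamma\backslash GL_2^+(\mathbb Q)\to\mathcal{QM}$, $\Gamma\alpha\mapsto F_\alpha$, of finite support with $F_{\alpha\gamma}=F_\alpha||\gamma$ for all $\gamma\in\Gamma$. Put $$(F^1*^rF^2)_\alpha=\sum_{\beta\in\Gamma\backslash SL_2(\mathbb Z)}F^1_\beta\cdot\big(F^2_{\alpha\beta^{-1}}||\beta\big),$$ and write $\mathcal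 Q^r(\Gamma)=(\mathcal Q(\Gamma),*^r)$. **The operators.** On $\mathcal{QM}$ put $D(f)=-\frac1{8\pi i}\sum_i i\,a_i(f)G_2^{i-1}G_2'$, where $G_2'$ is the derivative of $G_2$; $W_k(f)=\sum_i i\,a_i(f)G_2^{i+k-2}$ for $k\ge1$; $E(f)=G_4\cdot f$; and $T_k^l=E^lW_k$ for $k\ge 1$, $l\ge0$. They act on $\mathcal Q(\Gamma)$ by $D(F)_\alpha=D(F_\alpha)$ and $T_k^l(F)_\alpha=T_k^l(F_\alpha)$. For $m\ge1$ put $\nu_\alpha^{(m)}=-\frac5{24}(G_4^m|\alpha-G_4^m)$ and $\phi^{(m)}(F)_\alpha=\nu^{(m)}_\alpha\cdot F_\alpha$. **The Hopf algebra.** Let $\mathcal L$ be the complex Lie algebra with generators $D$, $T_k^l$ ($k\ge1$, $l\ge0$), $\phi^{(m)}$ ($m\ge1$) and relations $$[T_k^l,T_{k'}^{l'}]=(k'-k)T_{k+k'-2}^{l+l'},\qquad [T_k^l,D]=\tfrac5{24}(k-1)T_{k-1}^{l+1}-\tfrac12(k-3)T_{k+1}^l,$$ $$[D,\phi^{(m)}]=0,\qquad[T_k^l,\phi^{(m)}]=0,\qquad[\phi^{(m)},\phi^{(m')}]=0$$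 (a symbol $T_0^l$ occurs only with coefficient $0$). Let $\mathcal H=\mathcal U(\mathcal L)$ be its universal enveloping algebra, a Hopf algebra in which the elements of $\mathcal L$ are primitive: $\Delta(x)=x\otimes1+1\otimes x$. **Theorem.** Let $\Gamma=\Gamma(N)$, $N\ge1$, be a principal congruence subgroup. The product $*^r$ is well defined and makes $\mathcal Q^r(\Gamma)$ an associative (not necessarily unital) complex algebra. The operators $D$, $T_k^l$, $\phi^{(m)}$ on $\mathcal Q(\Gamma)$ are well defined and extend to an action of the algebra $\mathcal H$ on the vector space $\mathcal Q(\Gamma)$, in which each generator of $\mathcal L$ acts by the operator of the same name. This is a Hopf action of $\mathcal H$ on the algebra $\mathcal Q^r(\Gamma)$: $$h(F^1*^rF^2)=\sum h_{(1)}(F^1)*^rh_{(2)}(F^2)\qquad\text{for all }h\in\mathcal H,\ F^1,F^2\in\mathcal Q^r(\Gamma),$$ where $\Delta(h)=\sum h_{(1)}\otimes h_{(2)}$. -/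

import Mathlib

namespace QuasimodularHecke

open UpperHalfPlane Polynomial CongruenceSubgroup
open scoped MatrixGroups ModularForm Manifold DirectSum TensorProduct

/-! ### Enveloping algebras as Hopf algebras -/

section EnvelopingHopf

attribute [local instance 100] LieRing.ofAssociativeRing

variable (L : Type) [LieRing L] [LieAlgebra ℂ L]

local notation "U" => UniversalEnvelopingAlgebra ℂ L

/-- The coproduct of an enveloping algebra: the algebra map with `x ↦ x ⊗ 1 + 1 ⊗ x` on `L`. -/
noncomputable def envComul : U →ₐ[ℂ] U ⊗[ℂ] U :=
  UniversalEnvelopingAlgebra.lift ℂ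
    { toFun := fun x => UniversalEnvelopingAlgebra.ι ℂ x ⊗ₜ[ℂ] 1 +
        1 ⊗ₜ[ℂ] UniversalEnvelopingAlgebra.ι ℂ x
      map_add' := fun x y => by
        simp only [map_add, TensorProduct.add_tmul, TensorProduct.tmul_add]; abel
      map_smul' := fun c x => by
        simp only [map_smul, TensorProduct.smul_tmul', TensorProduct.tmul_smul, smul_add,
          RingHom.id_apply]
      map_lie' := fun {x y} => by
        simp only [LieHom.map_lie, LieRing.of_associative_ring_bracket, mul_add, add_mul,
          Algebra.TensorProduct.tmul_mul_tmul, one_mul, mul_one, TensorProduct.sub_tmul,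
          TensorProduct.tmul_sub]
        abel }

/-- The counit of an enveloping algebra, which kills `L`. -/
noncomputable def envCounit : U →ₐ[ℂ] ℂ := UniversalEnvelopingAlgebra.lift ℂ 0

/-- The antipode of an enveloping algebra: the anti-automorphism with `x ↦ -x` on `L`. -/
noncomputable def envAntipodeHom : U →ₐ[ℂ] (U)ᵐᵒᵖ :=
  UniversalEnvelopingAlgebra.lift ℂ
    { toFun := fun x => MulOpposite.op (-UniversalEnvelopingAlgebra.ι ℂ x)
      map_add' := fun x y => by simp only [map_add, neg_add, MulOpposite.op_add]
      map_smul' := fun c x => by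
        simp only [map_smul, RingHom.id_apply, ← MulOpposite.op_smul, smul_neg]
      map_lie' := fun {x y} => by
        simp only [LieHom.map_lie, LieRing.of_associative_ring_bracket, ← MulOpposite.op_mul,
          ← MulOpposite.op_sub]
        congr 1
        noncomm_ring }

theorem envComul_ι (x : L) : envComul L (UniversalEnvelopingAlgebra.ι ℂ x) =
    UniversalEnvelopingAlgebra.ι ℂ x ⊗ₜ[ℂ] 1 + 1 ⊗ₜ[ℂ] UniversalEnvelopingAlgebra.ι ℂ x :=
  UniversalEnvelopingAlgebra.lift_ι_apply ℂ _ x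

theorem envCounit_ι (x : L) : envCounit L (UniversalEnvelopingAlgebra.ι ℂ x) = 0 :=
  UniversalEnvelopingAlgebra.lift_ι_apply ℂ _ x

theorem envAntipodeHom_ι (x : L) : envAntipodeHom L (UniversalEnvelopingAlgebra.ι ℂ x) =
    MulOpposite.op (-UniversalEnvelopingAlgebra.ι ℂ x) :=
  UniversalEnvelopingAlgebra.lift_ι_apply ℂ _ x

theorem env_induction {P : U → Prop} (hι : ∀ x, P (UniversalEnvelopingAlgebra.ι ℂ x))
    (hc : ∀ c : ℂ, P (algebraMap ℂ U c)) (hadd : ∀ a b, P a → P b → P (a + b))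
    (hmul : ∀ a b, P a → P b → P (a * b)) (h : U) : P h := by
  obtain ⟨t, rfl⟩ : ∃ t, UniversalEnvelopingAlgebra.mkAlgHom ℂ L t = h := 
    RingCon.mkₐ_surjective _ h
  induction t using TensorAlgebra.induction with
  | algebraMap r => simpa using hc r
  | ι x => exact hι x
  | add a b ha hb => rw [map_add]; exact hadd _ _ ha hb
  | mul a b ha hb => rw [map_mul]; exact hmul _ _ ha hb

theorem env_hom_ext {A : Type*} [Ring A] [Algebra ℂ A] {f g : U →ₐ[ℂ] A}
    (h : ∀ x, f (UniversalEnvelopingAlgebra.ι ℂ x) = g (UniversalEnvelopingAlgebra.ι ℂ x)) :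
    f = g :=
  UniversalEnvelopingAlgebra.hom_ext ℂ (LieHom.ext h)

noncomputable instance envBialgebra : Bialgebra ℂ U :=
  Bialgebra.ofAlgHom (envComul L) (envCounit L)
    (by
      refine env_hom_ext L fun x => ?_
      simp only [AlgHom.comp_apply, envComul_ι, map_add, Algebra.TensorProduct.map_tmul,
        TensorProduct.add_tmul, TensorProduct.tmul_add, map_one, AlgHom.coe_id, id_eq,
        Algebra.TensorProduct.one_def, AlgEquiv.coe_toAlgHom,
        Algebra.TensorProduct.assoc_tmul]
      abel)
    (by
      refine env_hom_ext L fun x => ?_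
      simp [AlgHom.comp_apply, -UniversalEnvelopingAlgebra.ι_apply, envComul_ι, envCounit_ι])
    (by
      refine env_hom_ext L fun x => ?_
      simp [AlgHom.comp_apply, -UniversalEnvelopingAlgebra.ι_apply, envComul_ι, envCounit_ι])

/-- The antipode as a linear map. -/
noncomputable def envAntipode : U →ₗ[ℂ] U :=
  (MulOpposite.opLinearEquiv ℂ).symm.toLinearMap ∘ₗ (envAntipodeHom L).toLinearMap

theorem envAntipode_mul (a b : U) :
    envAntipode L (a * b) = envAntipode L b * envAntipode L a := by
  simp [envAntipode]

theorem envAntipode_ι (x : L) : envAntipode L (UniversalEnvelopingAlgebra.ι ℂ x) =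
    -UniversalEnvelopingAlgebra.ι ℂ x := by
  rw [envAntipode, LinearMap.comp_apply, AlgHom.toLinearMap_apply, envAntipodeHom_ι]
  simp

theorem envAntipode_left (h : U) (t : U ⊗[ℂ] U) :
    LinearMap.mul' ℂ U ((envAntipode L).rTensor U (envComul L h * t)) =
      envCounit L h • LinearMap.mul' ℂ U ((envAntipode L).rTensor U t) := by
  induction h using env_induction L generalizing t with
  | hι x =>
    rw [envCounit_ι, zero_smul, envComul_ι]
    induction t using TensorProduct.induction_on with
    | zero => simp
    | tmul u v =>
      simp only [add_mul, Algebra.TensorProduct.tmul_mul_tmul, one_mul, map_add,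
        LinearMap.rTensor_tmul, LinearMap.mul'_apply, envAntipode_mul, envAntipode_ι]
      noncomm_ring
    | add a b ha hb => rw [mul_add, map_add, map_add, ha, hb, add_zero]
  | hc c => simp [Algebra.algebraMap_eq_smul_one]
  | hadd a b ha hb => simp [add_mul, ha, hb, add_smul]
  | hmul a b ha hb => rw [map_mul (envComul L), mul_assoc, ha, hb, map_mul (envCounit L), smul_smul]

theorem envAntipode_right (h : U) (t : U ⊗[ℂ] U) :
    LinearMap.mul' ℂ U ((envAntipode L).lTensor U (t * envComul L h)) =
      envCounit L h • LinearMap.mul' ℂ U ((envAntipode L).lTensor U t) := by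
  induction h using env_induction L generalizing t with
  | hι x =>
    rw [envCounit_ι, zero_smul, envComul_ι]
    induction t using TensorProduct.induction_on with
    | zero => simp
    | tmul u v =>
      simp only [mul_add, Algebra.TensorProduct.tmul_mul_tmul, mul_one, map_add,
        LinearMap.lTensor_tmul, LinearMap.mul'_apply, envAntipode_mul, envAntipode_ι]
      noncomm_ring
    | add a b ha hb => rw [add_mul, map_add, map_add, ha, hb, add_zero]
  | hc c => simp [Algebra.algebraMap_eq_smul_one]
  | hadd a b ha hb => simp [mul_add, ha, hb, add_smul]
  | hmul a b ha hb => rw [map_mul (envComul L), ← mul_assoc, hb, ha, map_mul (envCounit L), smul_smul, mul_comm]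

/-- The enveloping algebra of a complex Lie algebra as a Hopf algebra. -/
noncomputable instance envHopfAlgebra : HopfAlgebra ℂ U where
  antipode := envAntipode L
  mul_antipode_rTensor_comul := by
    ext h
    have := envAntipode_left L h 1
    rw [mul_one] at this
    refine this.trans ?_
    have h1 : envAntipode L 1 = 1 := by simp [envAntipode]
    simp [Algebra.TensorProduct.one_def, h1, Algebra.algebraMap_eq_smul_one]
    rfl
  mul_antipode_lTensor_comul := by
    ext h
    have := envAntipode_right L h 1
    rw [one_mul] at this
    refine this.trans ?_
    have h1 : envAntipode L 1 = 1 := by simp [envAntipode]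
    simp [Algebra.TensorProduct.one_def, h1, Algebra.algebraMap_eq_smul_one]
    rfl

end EnvelopingHopf

/-! ### The Lie algebra and its Hopf algebra -/

/-- The generating symbols `D`, `T_k^l` (`k ≥ 1`, `l ≥ 0`) and `φ^(m)` (`m ≥ 1`). -/
inductive Gen : Type
  | D : Gen
  | T (k : ℕ+) (l : ℕ) : Gen
  | φ (m : ℕ+) : Gen

namespace Gen

/-- The symbols in the free Lie algebra. -/
noncomputable abbrev sym (g : Gen) : FreeLieAlgebra ℂ Gen := FreeLieAlgebra.of ℂ g

/-- The symbol `T_k^l` for a natural number `k`. The index `k = 0` only occurs with coefficient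
zero in the commutator relations; there the value is `0`. -/
noncomputable def symT (k l : ℕ) : FreeLieAlgebra ℂ Gen :=
  if hk : 0 < k then sym (T ⟨k, hk⟩ l) else 0

/-- The differences of the two sides of the commutator relations. -/
inductive Relator : FreeLieAlgebra ℂ Gen → Prop
  | TT (k k' : ℕ+) (l l' : ℕ) :
      Relator (⁅sym (T k l), sym (T k' l')⁆ -
        ((k' : ℂ) - (k : ℂ)) • symT ((k : ℕ) + (k' : ℕ) - 2) (l + l'))
  | Dφ (m : ℕ+) : Relator ⁅sym D, sym (φ m)⁆
  | Tφ (k : ℕ+) (l : ℕ) (m : ℕ+) : Relator ⁅sym (T k l), sym (φ m)⁆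
  | φφ (m m' : ℕ+) : Relator ⁅sym (φ m), sym (φ m')⁆
  | TD (k : ℕ+) (l : ℕ) :
      Relator (⁅sym (T k l), sym D⁆ -
        ((5 / 24 * ((k : ℂ) - 1)) • symT ((k : ℕ) - 1) (l + 1) -
          (1 / 2 * ((k : ℂ) - 3)) • symT ((k : ℕ) + 1) l))

end Gen

/-- The complex Lie algebra `L` with generators `D`, `T_k^l`, `φ^(m)` and the commutator
relations. -/
abbrev L : Type := FreeLieAlgebra ℂ Gen ⧸ LieSubmodule.lieSpan ℂ (FreeLieAlgebra ℂ Gen)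
  {x : FreeLieAlgebra ℂ Gen | Gen.Relator x}

/-- The Hopf algebra `H = U(L)`. -/
abbrev H : Type := UniversalEnvelopingAlgebra ℂ L

/-- The generators as elements of `H`. -/
noncomputable def Gen.toH (g : Gen) : H :=
  UniversalEnvelopingAlgebra.ι ℂ (LieSubmodule.Quotient.mk g.sym : L)

/-- The generators are primitive. -/
theorem comul_toH (g : Gen) :
    Coalgebra.comul (R := ℂ) g.toH = g.toH ⊗ₜ[ℂ] 1 + 1 ⊗ₜ[ℂ] g.toH :=
  envComul_ι L _

/-! ### Modular and quasimodular forms -/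

theorem modularForm_iff {N : ℕ} [NeZero N] {k : ℤ} {f : ℍ → ℂ} :
    (∃ g : ModularForm ((Gamma N).map (Matrix.SpecialLinearGroup.mapGL ℝ)) k, ⇑g = f) ↔
      MDiff f ∧ (∀ γ ∈ Gamma N, f ∣[k] γ = f) ∧
        ∀ δ : SL(2, ℤ), IsBoundedAtImInfty (f ∣[k] δ) := by
  constructor
  · rintro ⟨g, rfl⟩
    refine ⟨g.holo', fun γ hγ => ?_, fun δ => ModularFormClass.bdd_at_infty_slash g δ⟩
    exact g.slash_action_eq' _ ⟨γ, hγ, rfl⟩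
  · rintro ⟨h1, h2, h3⟩
    refine ⟨⟨⟨f, ?_⟩, h1, ?_⟩, rfl⟩
    · rintro _ ⟨γ, hγ, rfl⟩
      exact h2 γ hγ
    · intro c hc
      rw [Subgroup.IsArithmetic.isCusp_iff_isCusp_SL2Z] at hc
      rw [OnePoint.isBoundedAt_iff_forall_SL2Z hc]
      exact fun γ _ => h3 γ

/-- `f` is a modular form of weight `k` for some principal congruence subgroup `Γ(N)`. -/
def IsModular (k : ℤ) (f : ℍ → ℂ) : Prop :=
  ∃ N : ℕ, N ≠ 0 ∧
    ∃ g : ModularForm ((Gamma N).map (Matrix.SpecialLinearGroup.mapGL ℝ)) k, ⇑g = f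

/-- `f` is a quasimodular form of weight `k` on `Γ(N)`, with component functions
`f_j = P.coeff j`: all functions are holomorphic on the upper half plane, each `f_j` is bounded at
all cusps with respect to the weight `k - 2j`, and
`(cz+d)^(-k) f((az+b)/(cz+d)) = ∑ j, f_j(z) (c/(cz+d))^j` for all `(a b; c d)` in `Γ(N)`.
The depth is the degree of `P`, so the top component is nonzero unless `f = 0`. -/
structure IsQuasimodularWith (N : ℕ) (k : ℤ) (f : ℍ → ℂ) (P : (ℍ → ℂ)[X]) : Prop where
  holo : MDiff f
  coeff_holo : ∀ j, MDiff (P.coeff j)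
  coeff_bdd : ∀ j : ℕ, ∀ δ : SL(2, ℤ), IsBoundedAtImInfty (P.coeff j ∣[k - 2 * (j : ℤ)] δ)
  transf : ∀ γ ∈ Gamma N, ∀ z : ℍ, (f ∣[k] γ) z =
    P.sum fun j p => p z * ((γ 1 0 : ℂ) / denom γ z) ^ j

/-- `f` is a quasimodular form of weight `k` (of any depth) for some `Γ(N)`. -/
def IsQuasimodular (k : ℤ) (f : ℍ → ℂ) : Prop :=
  ∃ N : ℕ, N ≠ 0 ∧ ∃ P : (ℍ → ℂ)[X], IsQuasimodularWith N k f P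

theorem gamma_mono {N M : ℕ} (h : N ∣ M) : Gamma M ≤ Gamma N := by
  intro γ hγ
  rw [Gamma_mem] at hγ ⊢
  have key : ∀ a b : ℤ, (a : ZMod M) = (b : ZMod M) → (a : ZMod N) = (b : ZMod N) := by
    intro a b hab
    rw [ZMod.intCast_eq_intCast_iff] at hab ⊢
    exact hab.of_dvd (Int.natCast_dvd_natCast.mpr h)
  obtain ⟨h1, h2, h3, h4⟩ := hγ
  refine ⟨?_, ?_, ?_, ?_⟩
  · simpa using key _ 1 (by simpa using h1)
  · simpa using key _ 0 (by simpa using h2)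
  · simpa using key _ 0 (by simpa using h3)
  · simpa using key _ 1 (by simpa using h4)

theorem IsQuasimodularWith.mono {N M : ℕ} (h : N ∣ M) {k : ℤ} {f P}
    (hf : IsQuasimodularWith N k f P) : IsQuasimodularWith M k f P :=
  ⟨hf.holo, hf.coeff_holo, hf.coeff_bdd, fun γ hγ => hf.transf γ (gamma_mono h hγ)⟩

theorem IsQuasimodularWith.transf' {N : ℕ} {k : ℤ} {f P}
    (hf : IsQuasimodularWith N k f P) (γ : SL(2, ℤ)) (hγ : γ ∈ Gamma N) (z : ℍ) :
    (f ∣[k] γ) z = P.eval₂ (Pi.evalRingHom (fun _ : ℍ => ℂ) z) ((γ 1 0 : ℂ) / denom γ z) := by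
  rw [hf.transf γ hγ, eval₂_eq_sum]; rfl

theorem isQuasimodularWith_of {N : ℕ} {k : ℤ} {f : ℍ → ℂ} {P : (ℍ → ℂ)[X]} (h0 : MDiff f)
    (h1 : ∀ j, MDiff (P.coeff j))
    (h2 : ∀ j : ℕ, ∀ δ : SL(2, ℤ), IsBoundedAtImInfty (P.coeff j ∣[k - 2 * (j : ℤ)] δ))
    (h3 : ∀ γ ∈ Gamma N, ∀ z : ℍ, (f ∣[k] γ) z =
      P.eval₂ (Pi.evalRingHom (fun _ : ℍ => ℂ) z) ((γ 1 0 : ℂ) / denom γ z)) :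
    IsQuasimodularWith N k f P :=
  ⟨h0, h1, h2, fun γ hγ z => by rw [h3 γ hγ, eval₂_eq_sum]; rfl⟩

theorem bdd_add {f g : ℍ → ℂ} (hf : IsBoundedAtImInfty f) (hg : IsBoundedAtImInfty g) :
    IsBoundedAtImInfty (f + g) := (boundedAtImInftySubalgebra ℂ).add_mem hf hg

theorem bdd_mul {f g : ℍ → ℂ} (hf : IsBoundedAtImInfty f) (hg : IsBoundedAtImInfty g) :
    IsBoundedAtImInfty (f * g) := (boundedAtImInftySubalgebra ℂ).mul_mem hf hg

theorem bdd_smul (c : ℂ) {f : ℍ → ℂ} (hf : IsBoundedAtImInfty f) :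
    IsBoundedAtImInfty (c • f) := (boundedAtImInftySubalgebra ℂ).smul_mem hf c

theorem bdd_sum {ι : Type*} (s : Finset ι) {f : ι → ℍ → ℂ}
    (hf : ∀ i ∈ s, IsBoundedAtImInfty (f i)) : IsBoundedAtImInfty (∑ i ∈ s, f i) :=
  (boundedAtImInftySubalgebra ℂ).sum_mem hf

theorem mdiff_sum {ι : Type*} (s : Finset ι) {f : ι → ℍ → ℂ}
    (hf : ∀ i ∈ s, MDiff (f i)) : MDiff (∑ i ∈ s, f i) := by
  classical
  induction s using Finset.induction_on with
  | empty => simpa using! mdifferentiable_const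
  | insert a s ha ih =>
    rw [Finset.sum_insert ha]
    exact (hf a (by simp)).add (ih fun i hi => hf i (by simp [hi]))

theorem mdiff_smul (c : ℂ) {f : ℍ → ℂ} (hf : MDiff f) : MDiff (c • f) := hf.const_smul c

theorem IsQuasimodularWith.add {N : ℕ} {k : ℤ} {f g P Q}
    (hf : IsQuasimodularWith N k f P) (hg : IsQuasimodularWith N k g Q) :
    IsQuasimodularWith N k (f + g) (P + Q) := by
  refine isQuasimodularWith_of (hf.holo.add hg.holo) (fun j => ?_) (fun j δ => ?_)
    fun γ hγ z => ?_
  · rw [coeff_add]; exact (hf.coeff_holo j).add (hg.coeff_holo j)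
  · rw [coeff_add, SlashAction.add_slash]; exact bdd_add (hf.coeff_bdd j δ) (hg.coeff_bdd j δ)
  · rw [SlashAction.add_slash, Pi.add_apply, hf.transf' γ hγ, hg.transf' γ hγ, eval₂_add]

theorem IsQuasimodularWith.smul {N : ℕ} {k : ℤ} {f P} (c : ℂ)
    (hf : IsQuasimodularWith N k f P) : IsQuasimodularWith N k (c • f) (c • P) := by
  refine isQuasimodularWith_of (mdiff_smul c hf.holo) (fun j => ?_) (fun j δ => ?_)
    fun γ hγ z => ?_
  · rw [coeff_smul]; exact mdiff_smul c (hf.coeff_holo j)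
  · rw [coeff_smul, ModularForm.SL_smul_slash]; exact bdd_smul c (hf.coeff_bdd j δ)
  · have : c • P = C (fun _ => c) * P := by
      ext1 j; rw [coeff_smul, coeff_C_mul]; rfl
    rw [ModularForm.SL_smul_slash, Pi.smul_apply, hf.transf' γ hγ, this, eval₂_mul, eval₂_C]
    rfl

theorem IsQuasimodularWith.mul {N : ℕ} {k l : ℤ} {f g P Q}
    (hf : IsQuasimodularWith N k f P) (hg : IsQuasimodularWith N l g Q) :
    IsQuasimodularWith N (k + l) (f * g) (P * Q) := by
  refine isQuasimodularWith_of (hf.holo.mul hg.holo) (fun j => ?_) (fun j δ => ?_)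
    fun γ hγ z => ?_
  · rw [coeff_mul]
    exact mdiff_sum _ fun i _ => (hf.coeff_holo _).mul (hg.coeff_holo _)
  · rw [coeff_mul, SlashAction.sum_slash]
    refine bdd_sum _ fun i hi => ?_
    rw [Finset.HasAntidiagonal.mem_antidiagonal] at hi
    have : k + l - 2 * (j : ℤ) = (k - 2 * (i.1 : ℤ)) + (l - 2 * (i.2 : ℤ)) := by
      rw [← hi]; push_cast; ring
    rw [this, ModularForm.mul_slash_SL2]
    exact bdd_mul (hf.coeff_bdd _ δ) (hg.coeff_bdd _ δ)
  · rw [ModularForm.mul_slash_SL2, Pi.mul_apply, hf.transf' γ hγ, hg.transf' γ hγ, eval₂_mul]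

theorem isQuasimodularWith_C {N : ℕ} [NeZero N] {k : ℤ} {f : ℍ → ℂ}
    (hf : ∃ g : ModularForm ((Gamma N).map (Matrix.SpecialLinearGroup.mapGL ℝ)) k, ⇑g = f) :
    IsQuasimodularWith N k f (C f) := by
  obtain ⟨h1, h2, h3⟩ := modularForm_iff.mp hf
  refine isQuasimodularWith_of h1 (fun j => ?_) (fun j δ => ?_) fun γ hγ z => ?_
  · rw [coeff_C]; split_ifs
    · exact h1
    · exact mdifferentiable_const
  · rw [coeff_C]; split_ifs with h
    · simpa [h] using h3 δ
    · rw [SlashAction.zero_slash]; exact zero_form_isBoundedAtImInfty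
  · rw [h2 γ hγ, eval₂_C]; rfl

theorem IsModular.isQuasimodular {k : ℤ} {f : ℍ → ℂ} (hf : IsModular k f) :
    IsQuasimodular k f := by
  obtain ⟨N, hN, hg⟩ := hf
  have : NeZero N := ⟨hN⟩
  exact ⟨N, hN, _, isQuasimodularWith_C hg⟩

theorem isModular_iff {k : ℤ} {f : ℍ → ℂ} : IsModular k f ↔ ∃ N : ℕ, N ≠ 0 ∧
    MDiff f ∧ (∀ γ ∈ Gamma N, f ∣[k] γ = f) ∧
        ∀ δ : SL(2, ℤ), IsBoundedAtImInfty (f ∣[k] δ) := by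
  refine exists_congr fun N => and_congr_right fun hN => ?_
  have : NeZero N := ⟨hN⟩
  exact modularForm_iff

theorem IsModular.add {k : ℤ} {f g : ℍ → ℂ} (hf : IsModular k f) (hg : IsModular k g) :
    IsModular k (f + g) := by
  rw [isModular_iff] at *
  obtain ⟨N, hN, h1, h2, h3⟩ := hf
  obtain ⟨M, hM, h1', h2', h3'⟩ := hg
  refine ⟨N * M, mul_ne_zero hN hM, h1.add h1', fun γ hγ => ?_, fun δ => ?_⟩
  · rw [SlashAction.add_slash, h2 γ (gamma_mono (dvd_mul_right _ _) hγ),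
      h2' γ (gamma_mono (dvd_mul_left _ _) hγ)]
  · rw [SlashAction.add_slash]; exact bdd_add (h3 δ) (h3' δ)

theorem IsModular.mul {k l : ℤ} {f g : ℍ → ℂ} (hf : IsModular k f) (hg : IsModular l g) :
    IsModular (k + l) (f * g) := by
  rw [isModular_iff] at *
  obtain ⟨N, hN, h1, h2, h3⟩ := hf
  obtain ⟨M, hM, h1', h2', h3'⟩ := hg
  refine ⟨N * M, mul_ne_zero hN hM, h1.mul h1', fun γ hγ => ?_, fun δ => ?_⟩
  · rw [ModularForm.mul_slash_SL2, h2 γ (gamma_mono (dvd_mul_right _ _) hγ),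
      h2' γ (gamma_mono (dvd_mul_left _ _) hγ)]
  · rw [ModularForm.mul_slash_SL2]; exact bdd_mul (h3 δ) (h3' δ)

theorem IsModular.smul {k : ℤ} {f : ℍ → ℂ} (c : ℂ) (hf : IsModular k f) :
    IsModular k (c • f) := by
  rw [isModular_iff] at *
  obtain ⟨N, hN, h1, h2, h3⟩ := hf
  refine ⟨N, hN, mdiff_smul c h1, fun γ hγ => ?_, fun δ => ?_⟩
  · rw [ModularForm.SL_smul_slash, h2 γ hγ]
  · rw [ModularForm.SL_smul_slash]; exact bdd_smul c (h3 δ)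

theorem isModular_zero (k : ℤ) : IsModular k 0 :=
  ⟨1, one_ne_zero, 0, rfl⟩

theorem isModular_one : IsModular 0 1 :=
  ⟨1, one_ne_zero, 1, rfl⟩

/-- The modular forms of weight `k` and arbitrary level `Γ(N)`, `N ≥ 1`. -/
def modularSpace (k : ℕ) : Submodule ℂ (ℍ → ℂ) where
  carrier := {f | IsModular k f}
  add_mem' := IsModular.add
  zero_mem' := isModular_zero k
  smul_mem' c _ hf := hf.smul c

/-- The quasimodular forms of weight `k`, of arbitrary depth and arbitrary level
`Γ(N)`, `N ≥ 1`. -/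
def quasimodularSpace (k : ℕ) : Submodule ℂ (ℍ → ℂ) where
  carrier := {f | IsQuasimodular k f}
  add_mem' := by
    rintro f g ⟨N, hN, P, hP⟩ ⟨M, hM, Q, hQ⟩
    exact ⟨N * M, mul_ne_zero hN hM, P + Q,
      (hP.mono (dvd_mul_right _ _)).add (hQ.mono (dvd_mul_left _ _))⟩
  zero_mem' := (isModular_zero k).isQuasimodular
  smul_mem' := by
    rintro c f ⟨N, hN, P, hP⟩
    exact ⟨N, hN, _, hP.smul c⟩

instance modularGraded : SetLike.GradedMonoid modularSpace where
  one_mem := isModular_one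
  mul_mem i j f g hf hg := by
    have := IsModular.mul (k := i) (l := j) hf hg
    rwa [← Nat.cast_add] at this

instance quasimodularGraded : SetLike.GradedMonoid quasimodularSpace where
  one_mem := isModular_one.isQuasimodular
  mul_mem i j f g := by
    rintro ⟨N, hN, P, hP⟩ ⟨M, hM, Q, hQ⟩
    refine ⟨N * M, mul_ne_zero hN hM, P * Q, ?_⟩
    rw [Nat.cast_add]
    exact (hP.mono (dvd_mul_right _ _)).mul (hQ.mono (dvd_mul_left _ _))

/-! ### The towers -/

/-- The direct sum `⨁ k, A k` of a multiplicative family of spaces of functions on the upper half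
plane, with its ring structure. -/
def Tower (A : ℕ → Submodule ℂ (ℍ → ℂ)) : Type := ⨁ k : ℕ, A k

namespace Tower

variable (A : ℕ → Submodule ℂ (ℍ → ℂ)) [SetLike.GradedMonoid A]

noncomputable instance : CommRing (Tower A) := inferInstanceAs (CommRing (⨁ k : ℕ, A k))

noncomputable instance : Algebra ℂ (Tower A) := inferInstanceAs (Algebra ℂ (⨁ k : ℕ, A k))

/-- The element of the tower given by a function of weight `k`. -/
noncomputable def of (k : ℕ) : A k →ₗ[ℂ] Tower A := DirectSum.lof ℂ ℕ (fun k => A k) k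

/-- The component of weight `k`. -/
noncomputable def component (k : ℕ) : Tower A →ₗ[ℂ] A k := DirectSum.component ℂ ℕ (fun k => A k) k

variable {A}

theorem ext {x y : Tower A} (h : ∀ k, component A k x = component A k y) : x = y :=
  DFinsupp.ext h

theorem component_of (k : ℕ) (a : A k) (n : ℕ) :
    ((component A n (of A k a) : A n) : ℍ → ℂ) = if k = n then (a : ℍ → ℂ) else 0 := by
  split_ifs with h
  · subst h
    exact congrArg Subtype.val (DirectSum.of_eq_same (β := fun k => A k) k a)
  · exact congrArg Subtype.val (DirectSum.of_eq_of_ne (β := fun k => A k) k n a (Ne.symm h))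

theorem induction {P : Tower A → Prop} (h0 : P 0) (hof : ∀ k a, P (of A k a))
    (hadd : ∀ x y, P x → P y → P (x + y)) (x : Tower A) : P x :=
  DirectSum.induction_on x h0 hof hadd

theorem of_mul_of {i j : ℕ} (a : A i) (b : A j) : of A i a * of A j b =
    of A (i + j) ⟨(a : ℍ → ℂ) * b, SetLike.mul_mem_graded a.2 b.2⟩ :=
  DirectSum.of_mul_of (A := fun k => A k) a b

theorem one_eq : (1 : Tower A) = of A 0 ⟨1, SetLike.one_mem_graded A⟩ := rfl

theorem component_mul_of (r : Tower A) {i : ℕ} (b : A i) (n : ℕ) :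
    ((component A n (r * of A i b) : A n) : ℍ → ℂ) =
      if i ≤ n then (component A (n - i) r : ℍ → ℂ) * b else 0 :=
  DirectSum.coe_mul_of_apply A r b n

/-- The algebra map between towers given by multiplicative linear maps in each weight. -/
noncomputable def map {B : ℕ → Submodule ℂ (ℍ → ℂ)} [SetLike.GradedMonoid B]
    (f : ∀ k, A k →ₗ[ℂ] B k)
    (hone : (f 0 ⟨1, SetLike.one_mem_graded A⟩ : ℍ → ℂ) = 1)
    (hmul : ∀ i j (a : A i) (b : A j),
      (f (i + j) ⟨(a : ℍ → ℂ) * b, SetLike.mul_mem_graded a.2 b.2⟩ : ℍ → ℂ) = f i a * f j b) :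
    Tower A →ₐ[ℂ] Tower B :=
  DirectSum.toAlgebra (B := Tower B) ℂ (fun k => A k) (fun k => (of B k).comp (f k))
    (by
      rw [one_eq]
      exact congrArg (of B 0) (Subtype.ext hone))
    (fun {i j} a b => by
      rw [LinearMap.comp_apply, LinearMap.comp_apply, LinearMap.comp_apply, of_mul_of]
      exact congrArg (of B (i + j)) (Subtype.ext (hmul i j a b)))

theorem map_of {B : ℕ → Submodule ℂ (ℍ → ℂ)} [SetLike.GradedMonoid B]
    (f : ∀ k, A k →ₗ[ℂ] B k) (hone hmul) (k : ℕ) (a : A k) :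
    map f hone hmul (of A k a) = of B k (f k a) :=
  DirectSum.toAddMonoid_of (fun k => ((of B k).comp (f k)).toAddMonoidHom) k a

end Tower

/-- The modular tower `M`, the direct sum over the weights of the modular forms of all levels. -/
abbrev MTower : Type := Tower modularSpace

/-- The quasimodular tower `QM`. -/
abbrev QMTower : Type := Tower quasimodularSpace

theorem modularSpace_le (k : ℕ) : modularSpace k ≤ quasimodularSpace k :=
  fun _ hf => IsModular.isQuasimodular hf

/-- The inclusion of the modular tower in the quasimodular tower. -/
noncomputable def incl : MTower →ₐ[ℂ] QMTower :=
  Tower.map (fun k => Submodule.inclusion (modularSpace_le k)) rfl fun _ _ _ _ => rfl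

theorem incl_of (k : ℕ) (a : modularSpace k) : incl (Tower.of modularSpace k a) =
    Tower.of quasimodularSpace k ⟨a, modularSpace_le k a.2⟩ :=
  Tower.map_of (fun k => Submodule.inclusion (modularSpace_le k)) rfl (fun _ _ _ _ => rfl) k a

/-! ### Eisenstein series -/

/-- The Eisenstein series
`G_K(z) = -B_K / (2K) + ∑_{n ≥ 1} (∑_{d ∣ n} d^(K-1)) e^(2πinz)`. -/
noncomputable def eisensteinG (K : ℕ) (z : ℍ) : ℂ :=
  -(_root_.bernoulli K : ℂ) / (2 * K) + ∑' n : ℕ+, (∑ d ∈ (n : ℕ).divisors, (d : ℂ) ^ (K - 1)) *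
    Complex.exp (2 * Real.pi * Complex.I * (n : ℕ) * z)

theorem eisensteinG_four : eisensteinG 4 = (1 / 240 : ℂ) • ⇑ModularForm.E₄ := by
  ext z
  have h := EisensteinSeries.q_expansion_bernoulli (k := 4) (by norm_num) (by decide) z
  have hb : _root_.bernoulli 4 = -1 / 30 := by
    rw [bernoulli_eq_bernoulli'_of_ne_one (by norm_num)]; exact bernoulli'_four
  rw [Pi.smul_apply]
  erw [h]
  rw [eisensteinG, hb]
  have : ∀ n : ℕ+, (∑ d ∈ (n : ℕ).divisors, (d : ℂ) ^ (4 - 1)) *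
      Complex.exp (2 * Real.pi * Complex.I * (n : ℕ) * z) =
      (ArithmeticFunction.sigma (4 - 1) (n : ℕ) : ℂ) *
        Complex.exp (2 * Real.pi * Complex.I * z) ^ ((n : ℕ) : ℤ) := by
    intro n
    rw [ArithmeticFunction.sigma_apply, zpow_natCast, ← Complex.exp_nat_mul]
    push_cast
    congr 2
    ring
  simp_rw [this]
  push_cast
  rw [smul_eq_mul]
  ring_nf

theorem eisensteinG_two : eisensteinG 2 = (-1 / 24 : ℂ) • EisensteinSeries.E2 := by
  ext z
  have h := EisensteinSeries.E2_eq_tsum_cexp z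
  have hb : _root_.bernoulli 2 = 1 / 6 := by
    rw [bernoulli_eq_bernoulli'_of_ne_one (by norm_num)]; exact bernoulli'_two
  rw [Pi.smul_apply, h, eisensteinG, hb]
  have : ∀ n : ℕ+, (∑ d ∈ (n : ℕ).divisors, (d : ℂ) ^ (2 - 1)) *
      Complex.exp (2 * Real.pi * Complex.I * (n : ℕ) * z) =
      (ArithmeticFunction.sigma 1 (n : ℕ) : ℂ) *
        Complex.exp (2 * Real.pi * Complex.I * z) ^ (n : ℕ) := by
    intro n
    rw [ArithmeticFunction.sigma_apply, ← Complex.exp_nat_mul]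
    push_cast
    congr 2
    ring
  simp_rw [this]
  push_cast
  rw [smul_eq_mul]
  ring

theorem isModular_eisensteinG_four : IsModular 4 (eisensteinG 4) := by
  rw [eisensteinG_four]
  refine IsModular.smul _ ⟨1, one_ne_zero, ?_⟩
  have : (Gamma 1).map (Matrix.SpecialLinearGroup.mapGL ℝ) = 𝒮ℒ := by
    rw [Gamma_one_coe_eq_SL]
  exact ⟨ModularForm.E₄.copy _ rfl this, rfl⟩

/-- The constant in the transformation law of `G_2`. -/
noncomputable def g2const : ℂ := Complex.I / (4 * Real.pi)

theorem g2const_ne_zero : g2const ≠ 0 := by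
  simp [g2const, Real.pi_ne_zero]

/-- The cocycle `c / (cz + d)`. -/
noncomputable def cocyc (γ : SL(2, ℤ)) (z : ℍ) : ℂ := (γ 1 0 : ℂ) / denom γ z

theorem eisensteinG_two_slash (γ : SL(2, ℤ)) :
    eisensteinG 2 ∣[(2 : ℤ)] γ = eisensteinG 2 + g2const • cocyc γ := by
  rw [eisensteinG_two, ModularForm.SL_smul_slash, EisensteinSeries.E2_slash_action, smul_sub,
    sub_eq_add_neg]
  congr 1
  ext z
  simp only [Pi.neg_apply, Pi.smul_apply, EisensteinSeries.D2, cocyc, smul_eq_mul, g2const,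
    riemannZeta_two]
  have := Real.pi_ne_zero
  have : (Real.pi : ℂ) ≠ 0 := by exact_mod_cast this
  field_simp
  ring

theorem mdiff_eisensteinG_two : MDiff (eisensteinG 2) := by
  rw [eisensteinG_two]; exact mdiff_smul _ E2_mdifferentiable

theorem bdd_eisensteinG_two : IsBoundedAtImInfty (eisensteinG 2) := by
  rw [eisensteinG_two]; exact bdd_smul _ EisensteinSeries.isBoundedAtImInfty_E2

theorem bdd_cocyc (γ : SL(2, ℤ)) : IsBoundedAtImInfty (cocyc γ) := by
  rw [isBoundedAtImInfty_iff]
  refine ⟨1, 1, fun z hz => ?_⟩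
  by_cases hc : γ 1 0 = 0
  · simp [cocyc, hc]
  · have h1 : |(γ 1 0 : ℝ)| ≤ ‖denom γ z‖ := by
      have h2 : (denom γ z).im = (γ 1 0 : ℝ) * z.im := by
        rw [ModularGroup.denom_apply]; simp
      calc |(γ 1 0 : ℝ)| ≤ |(γ 1 0 : ℝ) * z.im| := by
            rw [abs_mul]; exact le_mul_of_one_le_right (abs_nonneg _) (hz.trans (le_abs_self _))
        _ ≤ _ := by rw [← h2]; exact Complex.abs_im_le_norm _
    rw [cocyc, norm_div]
    refine div_le_one_of_le₀ ?_ (norm_nonneg _)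
    rw [Complex.norm_intCast]; exact h1

theorem isQuasimodularWith_eisensteinG_two :
    IsQuasimodularWith 1 2 (eisensteinG 2) (C (eisensteinG 2) + C (fun _ => g2const) * X) := by
  refine isQuasimodularWith_of mdiff_eisensteinG_two (fun j => ?_) (fun j δ => ?_)
    fun γ _ z => ?_
  · match j with
    | 0 => simpa using mdiff_eisensteinG_two
    | 1 => simpa [coeff_C] using! mdifferentiable_const
    | j + 2 => simpa [coeff_C, coeff_X] using! mdifferentiable_const
  · match j with
    | 0 =>
      simp only [coeff_add, coeff_C_zero, mul_coeff_zero, coeff_X_zero, mul_zero, add_zero,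
        Nat.cast_zero, sub_zero]
      rw [eisensteinG_two_slash]
      exact bdd_add bdd_eisensteinG_two (bdd_smul _ (bdd_cocyc δ))
    | 1 =>
      have : (C (eisensteinG 2) + C (fun _ : ℍ => g2const) * X).coeff 1 =
        fun _ => g2const := by simp [coeff_C]
      rw [this]
      have h := ModularForm.is_invariant_const δ g2const
      simp only [Nat.cast_one, mul_one, sub_self]
      erw [h]
      exact Filter.const_boundedAtFilter _ _
    | j + 2 =>
      have : (C (eisensteinG 2) + C (fun _ : ℍ => g2const) * X).coeff (j + 2) = 0 := by
        simp [coeff_X]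
      rw [this, SlashAction.zero_slash]
      exact zero_form_isBoundedAtImInfty
  · rw [eisensteinG_two_slash]
    simp [cocyc]

/-- The derivative `G_2'`. -/
noncomputable def eisensteinG2' (z : ℍ) : ℂ := deriv (eisensteinG 2 ∘ ofComplex) z

theorem eisensteinG2'_eq : eisensteinG2' =
    (2 * Real.pi * Complex.I : ℂ) • Derivative.normalizedDerivOfComplex (eisensteinG 2) := by
  ext z
  rw [Pi.smul_apply, Derivative.normalizedDerivOfComplex, smul_eq_mul,
    mul_inv_cancel_left₀ Complex.two_pi_I_ne_zero, eisensteinG2']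

theorem mdiff_cocyc (γ : SL(2, ℤ)) : MDiff (cocyc γ) := by
  have h := EisensteinSeries.E2_slash_action γ
  have h2 : g2const • cocyc γ = eisensteinG 2 ∣[(2 : ℤ)] γ - eisensteinG 2 := by
    rw [eisensteinG_two_slash]; abel
  have h3 : MDiff (g2const • cocyc γ) := by
    rw [h2]
    exact (MDifferentiable.slash mdiff_eisensteinG_two 2 _).sub mdiff_eisensteinG_two
  have h4 := mdiff_smul g2const⁻¹ h3
  rwa [inv_smul_smul₀ g2const_ne_zero] at h4

theorem deriv_cocyc (γ : SL(2, ℤ)) (z : ℍ) :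
    deriv (cocyc γ ∘ ofComplex) z = -(cocyc γ z) ^ 2 := by
  have hd := hasDerivAt_denom_zpow (γ : GL (Fin 2) ℝ) (-1) z
  have hne : denom γ z ≠ 0 := denom_ne_zero _ z
  have h1 : (cocyc γ ∘ ofComplex) =ᶠ[nhds (z : ℂ)]
      fun w => (γ 1 0 : ℂ) * denom γ w ^ (-1 : ℤ) := by
    filter_upwards [isOpen_upperHalfPlaneSet.mem_nhds z.im_pos] with w hw
    simp only [Function.comp_apply, cocyc, ofComplex_apply_of_im_pos hw, zpow_neg_one]
    rfl
  rw [h1.deriv_eq, (hd.const_mul _).deriv, cocyc]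
  have h2 : (((γ : GL (Fin 2) ℝ) 1 0 : ℝ) : ℂ) = (γ 1 0 : ℂ) := by simp
  rw [h2, show (-1 - 1 : ℤ) = -2 by norm_num, zpow_neg, div_pow]
  push_cast
  field_simp

theorem eisensteinG2'_slash (γ : SL(2, ℤ)) (z : ℍ) :
    (eisensteinG2' ∣[(4 : ℤ)] γ) z = eisensteinG2' z + 2 * eisensteinG 2 z * cocyc γ z +
      g2const * cocyc γ z ^ 2 := by
  have h := congrFun (Derivative.normalizedDerivOfComplex_SL_slash (k := 2)
    mdiff_eisensteinG_two (γ := γ)) z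
  rw [eisensteinG_two_slash, Derivative.normalizedDerivOfComplex_add _ _ mdiff_eisensteinG_two
    (mdiff_smul _ (mdiff_cocyc γ)), Derivative.normalizedDerivOfComplex_smul _ _ (mdiff_cocyc γ)]
    at h
  simp only [Pi.add_apply, Pi.sub_apply, Pi.smul_apply, smul_eq_mul] at h
  have h3 : Derivative.normalizedDerivOfComplex (cocyc γ) z =
      (2 * Real.pi * Complex.I)⁻¹ * (-(cocyc γ z) ^ 2) := by
    rw [Derivative.normalizedDerivOfComplex, deriv_cocyc]
  rw [h3] at h
  have h4 : ((2 : ℤ) + 2) = 4 := by norm_num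
  rw [h4] at h
  rw [eisensteinG2'_eq, ModularForm.SL_smul_slash, Pi.smul_apply, Pi.smul_apply, smul_eq_mul,
    smul_eq_mul, sub_eq_iff_eq_add.mp h.symm]
  have hc : (γ 1 0 : ℂ) / denom γ z = cocyc γ z := rfl
  rw [hc]
  have := Complex.two_pi_I_ne_zero
  field_simp
  push_cast
  ring

theorem bdd_eisensteinG2' : IsBoundedAtImInfty eisensteinG2' := by
  obtain ⟨C, A, hA⟩ := isBoundedAtImInfty_iff.mp bdd_eisensteinG_two
  rw [isBoundedAtImInfty_iff]
  refine ⟨C / 1, max A 0 + 2, fun z hz => ?_⟩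
  have hdiff := UpperHalfPlane.mdifferentiable_iff.mp mdiff_eisensteinG_two
  have him : ∀ w ∈ Metric.closedBall (z : ℂ) 1, max A 0 + 1 ≤ w.im := by
    intro w hw
    rw [mem_closedBall_iff_norm] at hw
    have h1 := (Complex.abs_im_le_norm (w - z)).trans hw
    rw [Complex.sub_im, abs_le] at h1
    have : (z : ℂ).im = z.im := rfl
    linarith [h1.1]
  refine Complex.norm_deriv_le_of_forall_mem_sphere_norm_le one_pos ?_ ?_
  · refine DifferentiableOn.diffContOnCl_ball (U := upperHalfPlaneSet) hdiff ?_
    intro w hw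
    have := him w hw
    exact lt_of_lt_of_le (by positivity) this
  · intro w hw
    have h1 := him w (Metric.sphere_subset_closedBall hw)
    have h2 : 0 < w.im := lt_of_lt_of_le (by positivity) h1
    rw [Function.comp_apply, ofComplex_apply_of_im_pos h2]
    refine hA _ ?_
    change A ≤ w.im
    linarith [le_max_left A 0]

theorem isQuasimodularWith_eisensteinG2' :
    IsQuasimodularWith 1 4 eisensteinG2'
      (C eisensteinG2' + C ((2 : ℂ) • eisensteinG 2) * X + C (fun _ => g2const) * X ^ 2) := by
  have hm : MDiff eisensteinG2' := by
    rw [eisensteinG2'_eq]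
    exact mdiff_smul _ (Derivative.normalizedDerivOfComplex_mdifferentiable mdiff_eisensteinG_two)
  have c0 : (C eisensteinG2' + C ((2 : ℂ) • eisensteinG 2) * X +
      C (fun _ : ℍ => g2const) * X ^ 2).coeff 0 = eisensteinG2' := by simp
  have c1 : (C eisensteinG2' + C ((2 : ℂ) • eisensteinG 2) * X +
      C (fun _ : ℍ => g2const) * X ^ 2).coeff 1 = (2 : ℂ) • eisensteinG 2 := by
    simp [coeff_C, coeff_X_pow]
  have c2 : (C eisensteinG2' + C ((2 : ℂ) • eisensteinG 2) * X +
      C (fun _ : ℍ => g2const) * X ^ 2).coeff 2 = fun _ => g2const := by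
    simp [coeff_C, coeff_X]
  have c3 : ∀ j, (C eisensteinG2' + C ((2 : ℂ) • eisensteinG 2) * X +
      C (fun _ : ℍ => g2const) * X ^ 2).coeff (j + 3) = 0 := by
    intro j; simp [coeff_C, coeff_X, coeff_X_pow]
  refine isQuasimodularWith_of hm (fun j => ?_) (fun j δ => ?_) fun γ _ z => ?_
  · match j with
    | 0 => rw [c0]; exact hm
    | 1 => rw [c1]; exact mdiff_smul _ mdiff_eisensteinG_two
    | 2 => rw [c2]; exact mdifferentiable_const
    | j + 3 => rw [c3]; exact mdifferentiable_const
  · match j with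
    | 0 =>
      rw [c0]
      have : eisensteinG2' ∣[(4 : ℤ) - 2 * ((0 : ℕ) : ℤ)] δ = eisensteinG2' +
          (2 : ℂ) • (eisensteinG 2 * cocyc δ) + g2const • (cocyc δ * cocyc δ) := by
        ext z
        simp only [Nat.cast_zero, mul_zero, sub_zero]
        rw [eisensteinG2'_slash]
        simp only [Pi.add_apply, Pi.smul_apply, Pi.mul_apply, smul_eq_mul]
        ring
      rw [this]
      exact bdd_add (bdd_add bdd_eisensteinG2'
        (bdd_smul _ (bdd_mul bdd_eisensteinG_two (bdd_cocyc δ))))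
        (bdd_smul _ (bdd_mul (bdd_cocyc δ) (bdd_cocyc δ)))
    | 1 =>
      rw [c1, ModularForm.SL_smul_slash]
      simp only [Nat.cast_one, mul_one]
      rw [show (4 : ℤ) - 2 = 2 by norm_num, eisensteinG_two_slash]
      exact bdd_smul _ (bdd_add bdd_eisensteinG_two (bdd_smul _ (bdd_cocyc δ)))
    | 2 =>
      rw [c2]
      have h := ModularForm.is_invariant_const δ g2const
      rw [show (4 : ℤ) - 2 * ((2 : ℕ) : ℤ) = 0 by norm_num]
      erw [h]
      exact Filter.const_boundedAtFilter _ _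
    | j + 3 =>
      rw [c3, SlashAction.zero_slash]
      exact zero_form_isBoundedAtImInfty
  · rw [eisensteinG2'_slash]
    simp [cocyc]

/-! ### Every quasimodular form is uniquely a polynomial in `G_2` over the modular forms -/

theorem cocyc_mul (A B : SL(2, ℤ)) (z : ℍ) :
    cocyc (A * B) z = cocyc A (B • z) * denom B z ^ (-2 : ℤ) + cocyc B z := by
  have h := congrFun (EisensteinSeries.D2_mul A B) z
  rw [Pi.add_apply, ModularForm.SL_slash_apply] at h
  have e : ∀ (γ : SL(2, ℤ)) (w : ℍ), EisensteinSeries.D2 γ w =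
      2 * Real.pi * Complex.I * cocyc γ w := by
    intro γ w; rw [EisensteinSeries.D2, cocyc, mul_div_assoc]
  rw [e, e, e] at h
  refine mul_left_cancel₀ Complex.two_pi_I_ne_zero ?_
  rw [h]; ring

/-- The lower unipotent matrices in `Γ(N)`. -/
def unip (N m : ℕ) : SL(2, ℤ) := ⟨!![1, 0; (N * m : ℤ), 1], by simp⟩

theorem unip_mem (N m : ℕ) : unip N m ∈ Gamma N := by
  rw [Gamma_mem]; simp [unip]

theorem cocyc_unip_injective {N : ℕ} (hN : N ≠ 0) (z : ℍ) :
    Function.Injective fun m : ℕ => cocyc (unip N m) z := by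
  intro m m' h
  have hd : ∀ n : ℕ, denom (unip N n) z = (N * n : ℂ) * z + 1 := by
    intro n; rw [ModularGroup.denom_apply]; simp [unip]
  have hne : ∀ n : ℕ, (N * n : ℂ) * z + 1 ≠ 0 := by
    intro n; rw [← hd]; exact denom_ne_zero _ _
  have hc : ∀ n : ℕ, cocyc (unip N n) z = (N * n : ℂ) / ((N * n : ℂ) * z + 1) := by
    intro n; rw [cocyc, hd]; simp [unip]
  simp only [hc] at h
  rw [div_eq_div_iff (hne _) (hne _)] at h
  have h2 : (N * m : ℂ) = N * m' := by linear_combination h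
  have h3 : (N : ℂ) ≠ 0 := by exact_mod_cast hN
  exact_mod_cast mul_left_cancel₀ h3 h2

theorem coeff_comp_linear {n : ℕ} (p : ℂ[X]) (hp : p.natDegree ≤ n) (a b : ℂ) :
    (p.comp (C a * X + C b)).coeff n = p.coeff n * a ^ n := by
  have hl : (C a * X + C b).natDegree ≤ 1 := natDegree_linear_le
  conv_lhs => rw [p.as_sum_range' (n + 1) (Nat.lt_succ_of_le hp)]
  rw [Polynomial.sum_comp, finsetSum_coeff, Finset.sum_range_succ, Finset.sum_eq_zero, zero_add]
  · rw [monomial_comp, coeff_C_mul]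
    have := coeff_pow_of_natDegree_le (m := n) hl
    rw [mul_one] at this
    rw [this]; simp
  · intro i hi
    rw [Finset.mem_range] at hi
    rw [monomial_comp, coeff_C_mul,
      coeff_eq_zero_of_natDegree_lt (p := (C a * X + C b) ^ i), mul_zero]
    exact lt_of_le_of_lt (natDegree_pow_le_of_le i hl) (by omega)

theorem IsQuasimodularWith.top_slash {N : ℕ} (hN : N ≠ 0) {k : ℤ} {f P}
    (hf : IsQuasimodularWith N k f P) {n : ℕ} (hn : P.natDegree ≤ n) (γ : SL(2, ℤ))
    (hγ : γ ∈ Gamma N) : P.coeff n ∣[k - 2 * (n : ℤ)] γ = P.coeff n := by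
  ext z
  set w : ℍ := γ • z with hw
  set j : ℂ := denom γ z with hj
  have hj0 : j ≠ 0 := denom_ne_zero _ _
  set ev : ℍ → (ℍ → ℂ) →+* ℂ := fun z => Pi.evalRingHom (fun _ : ℍ => ℂ) z with hev
  have key : (P.map (ev z)).comp (C (j ^ (-2 : ℤ)) * X + C (cocyc γ z)) =
      C (j ^ (-k)) * P.map (ev w) := by
    refine eq_of_infinite_eval_eq _ _ ((Set.infinite_range_of_injective
      (cocyc_unip_injective hN w)).mono ?_)
    rintro _ ⟨m, rfl⟩
    have h1 := hf.transf' (unip N m * γ) (mul_mem (unip_mem N m) hγ) z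
    rw [SlashAction.slash_mul, ModularForm.SL_slash_apply, hf.transf' _ (unip_mem N m)] at h1
    have h2 : ((unip N m * γ) 1 0 : ℂ) / denom (unip N m * γ : SL(2, ℤ)) z =
      cocyc (unip N m) w * j ^ (-2 : ℤ) + cocyc γ z := cocyc_mul _ _ _
    rw [h2] at h1
    simp only [Set.mem_ofPred_eq, eval_comp, eval_add, eval_mul, eval_C, eval_X, eval_map]
    rw [mul_comm (j ^ (-2 : ℤ)), ← h1, mul_comm]
    rfl
  have h3 := congrArg (fun p => coeff p n) key
  rw [coeff_comp_linear _ (natDegree_map_le.trans hn), coeff_C_mul, coeff_map, coeff_map] at h3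
  simp only [hev, Pi.evalRingHom_apply] at h3
  rw [ModularForm.SL_slash_apply, ← hw, ← hj]
  have h4 : j ^ (-(k - 2 * (n : ℤ))) = j ^ (-k) * (j ^ (2 : ℤ)) ^ n := by
    rw [← zpow_natCast, ← zpow_mul, ← zpow_add₀ hj0]; congr 1; ring
  rw [h4, ← mul_assoc, mul_comm (P.coeff n w), ← h3, mul_assoc, ← mul_pow, ← zpow_add₀ hj0]
  simp

/-- `G_2` as an element of the quasimodular tower. -/
noncomputable def G2 : QMTower :=
  Tower.of quasimodularSpace 2
    ⟨eisensteinG 2, 1, one_ne_zero, _, isQuasimodularWith_eisensteinG_two⟩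

/-- The derivative `G_2'` as an element of the quasimodular tower. -/
noncomputable def G2' : QMTower :=
  Tower.of quasimodularSpace 4
    ⟨eisensteinG2', 1, one_ne_zero, _, isQuasimodularWith_eisensteinG2'⟩

/-- `G_4` as an element of the modular tower. -/
noncomputable def G4 : MTower :=
  Tower.of modularSpace 4 ⟨eisensteinG 4, isModular_eisensteinG_four⟩

/-- Evaluation of polynomials over the modular tower at `G_2`. -/
noncomputable def evalG2 : MTower[X] →ₐ[ℂ] QMTower :=
  Polynomial.eval₂AlgHom incl G2 fun _ => Commute.all _ _

theorem coe_incl (x : MTower) (m : ℕ) :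
    (Tower.component quasimodularSpace m (incl x) : ℍ → ℂ) = Tower.component modularSpace m x := by
  induction x using Tower.induction with
  | h0 => simp
  | hof i a =>
    rw [incl_of, Tower.component_of, Tower.component_of]
  | hadd a b ha hb =>
    rw [map_add, map_add, map_add, Submodule.coe_add, ha, hb]; rfl

theorem G2_pow (i : ℕ) : ∃ h, G2 ^ i =
    Tower.of quasimodularSpace (2 * i) ⟨eisensteinG 2 ^ i, h⟩ := by
  induction i with
  | zero => exact ⟨SetLike.one_mem_graded quasimodularSpace, by rw [pow_zero, Tower.one_eq]; rfl⟩
  | succ i ih =>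
    obtain ⟨h, hi⟩ := ih
    refine ⟨?_, ?_⟩
    · rw [pow_succ]
      exact SetLike.mul_mem_graded h (⟨1, one_ne_zero, _, isQuasimodularWith_eisensteinG_two⟩ :
        eisensteinG 2 ∈ quasimodularSpace 2)
    · rw [pow_succ, hi, G2, Tower.of_mul_of]
      rfl

theorem evalG2_eq_sum (p : MTower[X]) :
    evalG2 p = ∑ i ∈ p.support, incl (p.coeff i) * G2 ^ i := by
  change eval₂ (incl : MTower →+* QMTower) G2 p = _
  rw [eval₂_eq_sum]; rfl

theorem evalG2_coe (p : MTower[X]) (k : ℕ) :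
    (Tower.component quasimodularSpace k (evalG2 p) : ℍ → ℂ) =
      ∑ i ∈ p.support, if 2 * i ≤ k then
        (Tower.component modularSpace (k - 2 * i) (p.coeff i) : ℍ → ℂ) * eisensteinG 2 ^ i
      else 0 := by
  rw [evalG2_eq_sum, map_sum, Submodule.coe_sum]
  refine Finset.sum_congr rfl fun i _ => ?_
  obtain ⟨hm, hi⟩ := G2_pow i
  rw [hi, Tower.component_mul_of]
  split_ifs
  · rw [coe_incl]
  · rfl

theorem common_level (s : Finset ℕ) (w : ℕ → ℤ) (a : ℕ → ℍ → ℂ) (ha : ∀ i, IsModular (w i) (a i)) :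
    ∃ N : ℕ, N ≠ 0 ∧ ∀ i ∈ s, ∀ γ ∈ Gamma N, a i ∣[w i] γ = a i := by
  choose N hN h using fun i => isModular_iff.mp (ha i)
  refine ⟨∏ i ∈ s, N i, Finset.prod_ne_zero_iff.mpr fun i _ => hN i, fun i hi γ hγ => ?_⟩
  exact (h i).2.1 γ (gamma_mono (Finset.dvd_prod_of_mem N hi) hγ)

theorem independent (s : Finset ℕ) (k : ℤ) (a : ℕ → ℍ → ℂ)
    (ha : ∀ i : ℕ, IsModular (k - 2 * (i : ℤ)) (a i)) (h : ∑ i ∈ s, a i * eisensteinG 2 ^ i = 0) :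
    ∀ i ∈ s, a i = 0 := by
  obtain ⟨N, hN, hinv⟩ := common_level s (fun i => k - 2 * (i : ℤ)) a ha
  intro i hi
  ext z
  set q : ℂ[X] := ∑ i ∈ s, monomial i (a i z) with hq
  have hq0 : q = 0 := by
    refine eq_of_infinite_eval_eq _ _ ((Set.infinite_range_of_injective (f := fun m : ℕ =>
      eisensteinG 2 z + g2const * cocyc (unip N m) z) ?_).mono ?_)
    · intro m m' hm
      exact cocyc_unip_injective hN z (mul_left_cancel₀ g2const_ne_zero (add_left_cancel hm))
    · rintro _ ⟨m, rfl⟩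
      have h1 : (∑ i ∈ s, a i * eisensteinG 2 ^ i) (unip N m • z) = 0 := by rw [h]; rfl
      have hj0 : denom (unip N m) z ≠ 0 := denom_ne_zero _ _
      set j : ℂ := denom (unip N m) z with hj
      have hg : eisensteinG 2 (unip N m • z) =
          j ^ (2 : ℤ) * (eisensteinG 2 z + g2const * cocyc (unip N m) z) := by
        have h2 := congrFun (eisensteinG_two_slash (unip N m)) z
        rw [ModularForm.SL_slash_apply, ← hj] at h2
        simp only [Pi.add_apply, Pi.smul_apply, smul_eq_mul] at h2
        rw [← h2, mul_comm, mul_assoc, ← zpow_add₀ hj0]; simp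
      have hai : ∀ i ∈ s, a i (unip N m • z) = j ^ (k - 2 * (i : ℤ)) * a i z := by
        intro i hi
        have h2 := congrFun (hinv i hi _ (unip_mem N m)) z
        rw [ModularForm.SL_slash_apply, ← hj] at h2
        rw [← h2, mul_comm, mul_assoc, ← zpow_add₀ hj0]; simp
      rw [Finset.sum_apply] at h1
      have h3 : j ^ k * ∑ i ∈ s, a i z * (eisensteinG 2 z + g2const * cocyc (unip N m) z) ^ i
          = 0 := by
        rw [Finset.mul_sum, ← h1]
        refine Finset.sum_congr rfl fun i hi => ?_
        rw [Pi.mul_apply, Pi.pow_apply, hai i hi, hg, mul_pow, zpow_sub₀ hj0,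
          zpow_mul j 2, zpow_natCast]
        have := pow_ne_zero i (zpow_ne_zero 2 hj0)
        field_simp
      have h4 := (mul_eq_zero.mp h3).resolve_left (zpow_ne_zero _ hj0)
      simp only [Set.mem_ofPred_eq, hq, eval_finsetSum, eval_monomial, eval_zero]
      exact h4
  have h5 : q.coeff i = a i z := by
    rw [hq, finsetSum_coeff]
    simp [coeff_monomial, hi]
  rw [← h5, hq0]; simp

theorem evalG2_injective : Function.Injective evalG2 := by
  rw [injective_iff_map_eq_zero]
  intro p hp
  refine Polynomial.ext fun i => ?_
  by_contra hi
  rw [coeff_zero] at hi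
  have hi' : i ∈ p.support := mem_support_iff.mpr hi
  refine hi ?_
  refine Tower.ext fun m => ?_
  have h := evalG2_coe p (m + 2 * i)
  rw [hp] at h
  have h2 := independent p.support ((m + 2 * i : ℕ) : ℤ)
    (fun j => if 2 * j ≤ m + 2 * i then (Tower.component modularSpace (m + 2 * i - 2 * j) (p.coeff j) : ℍ → ℂ) else 0)
    (fun j => ?_) ?_ i hi'
  · rw [if_pos (by omega), Nat.add_sub_cancel] at h2
    exact Subtype.ext h2
  · split_ifs with hj
    · have := (Tower.component modularSpace (m + 2 * i - 2 * j) (p.coeff j)).2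
      change IsModular ((m + 2 * i - 2 * j : ℕ) : ℤ) _ at this
      rw [Nat.cast_sub hj] at this
      exact_mod_cast this
    · exact isModular_zero _
  · simp only [ite_mul, zero_mul]
    exact h.symm

theorem of_mem_range_evalG2 {N : ℕ} (hN : N ≠ 0) (n : ℕ) : ∀ (k : ℕ) (f : ℍ → ℂ) (P : (ℍ → ℂ)[X]),
    P.degree < n → IsQuasimodularWith N k f P → ∀ hf : f ∈ quasimodularSpace k,
      Tower.of quasimodularSpace k ⟨f, hf⟩ ∈ evalG2.range := by
  have : NeZero N := ⟨hN⟩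
  induction n with
  | zero =>
    intro k f P hP h hf
    have hP0 : P = 0 := by
      rw [← degree_eq_bot]; simpa using hP
    have hf0 : f = 0 := by
      ext z
      have h1 := h.transf' 1 (one_mem _) z
      rw [SlashAction.slash_one, hP0, eval₂_zero] at h1
      exact h1
    have : (⟨f, hf⟩ : quasimodularSpace k) = 0 := Subtype.ext hf0
    rw [this, map_zero]
    exact zero_mem _
  | succ n ih =>
    intro k f P hP h hf
    have hn : P.natDegree ≤ n := natDegree_le_iff_coeff_eq_zero.mpr fun m hm =>
      (degree_lt_iff_coeff_zero P (n + 1)).mp hP m hm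
    set a := P.coeff n with ha
    have hmod : ∃ g : ModularForm ((Gamma N).map (Matrix.SpecialLinearGroup.mapGL ℝ))
        ((k : ℤ) - 2 * (n : ℤ)), ⇑g = a :=
      modularForm_iff.mpr ⟨h.coeff_holo n, h.top_slash hN hn, h.coeff_bdd n⟩
    by_cases hk : k < 2 * n
    · refine ih k f P ?_ h hf
      have ha0 : a = 0 := by
        obtain ⟨g, hg⟩ := hmod
        rw [← hg, ModularForm.isZero_of_neg_weight (by omega) g]; rfl
      rw [degree_lt_iff_coeff_zero]
      intro m hm
      rcases hm.eq_or_lt with rfl | hm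
      · exact ha0
      · exact coeff_eq_zero_of_natDegree_lt (lt_of_le_of_lt hn hm)
    · obtain ⟨m, rfl⟩ : ∃ m, k = m + 2 * n := ⟨k - 2 * n, by omega⟩
      have hm : (((m + 2 * n : ℕ) : ℤ) - 2 * (n : ℤ)) = m := by push_cast; ring
      rw [hm] at hmod
      have hb : ∃ g : ModularForm ((Gamma N).map (Matrix.SpecialLinearGroup.mapGL ℝ)) (m : ℤ),
          ⇑g = (g2const ^ n)⁻¹ • a := by
        obtain ⟨g, hg⟩ := hmod
        exact ⟨(g2const ^ n)⁻¹ • g, by rw [← hg]; rfl⟩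
      set b : ℍ → ℂ := (g2const ^ n)⁻¹ • a with hbdef
      have hbM : b ∈ modularSpace m := ⟨N, hN, hb⟩
      obtain ⟨hgm, hg⟩ := G2_pow n
      have hprod : Tower.of quasimodularSpace (m + 2 * n)
          ⟨b * eisensteinG 2 ^ n, SetLike.mul_mem_graded (modularSpace_le m hbM) hgm⟩ =
          evalG2 (monomial n (Tower.of modularSpace m ⟨b, hbM⟩)) := by
        have e1 : evalG2 (monomial n (Tower.of modularSpace m ⟨b, hbM⟩)) =
            incl (Tower.of modularSpace m ⟨b, hbM⟩) * G2 ^ n := by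
          change eval₂ (incl : MTower →+* QMTower) G2 _ = _
          rw [eval₂_monomial]; rfl
        have e2 : incl (Tower.of modularSpace m ⟨b, hbM⟩) =
            Tower.of quasimodularSpace m ⟨b, modularSpace_le m hbM⟩ := by
          exact incl_of _ _
        rw [e1, e2, hg, Tower.of_mul_of]
      set R : (ℍ → ℂ)[X] := C b * (C (eisensteinG 2) + C (fun _ => g2const) * X) ^ n with hR
      have hpow : ∀ i : ℕ, IsQuasimodularWith N (2 * (i : ℤ)) (eisensteinG 2 ^ i)
          ((C (eisensteinG 2) + C (fun _ => g2const) * X) ^ i) := by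
        intro i
        induction i with
        | zero =>
          have := isQuasimodularWith_C (N := N) (k := 0) (f := 1) ⟨1, rfl⟩
          simpa using! this
        | succ i ih =>
          have := ih.mul (isQuasimodularWith_eisensteinG_two.mono (one_dvd N))
          rw [pow_succ, pow_succ]
          convert! this using 1
      have hRq : IsQuasimodularWith N ((m + 2 * n : ℕ) : ℤ) (b * eisensteinG 2 ^ n) R := by
        have := (isQuasimodularWith_C hb).mul (hpow n)
        push_cast
        exact this
      have hlin : (C (eisensteinG 2) + C (fun _ : ℍ => g2const) * X).natDegree ≤ 1 := by
        rw [add_comm]; exact natDegree_linear_le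
      have hRn : R.coeff n = a := by
        have := coeff_pow_of_natDegree_le (m := n) hlin
        rw [mul_one] at this
        rw [hR, coeff_C_mul, this]
        ext z
        have h1 : (C (eisensteinG 2) + C (fun _ : ℍ => g2const) * X).coeff 1 =
          fun _ => g2const := by simp [coeff_C]
        rw [h1, Pi.mul_apply, Pi.pow_apply, hbdef, Pi.smul_apply, smul_eq_mul]
        have := pow_ne_zero n g2const_ne_zero
        field_simp
      have hRd : R.natDegree ≤ n :=
        (natDegree_C_mul_le _ _).trans ((natDegree_pow_le_of_le n hlin).trans (by simp))
      have hsub : IsQuasimodularWith N ((m + 2 * n : ℕ) : ℤ)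
          (f + (-1 : ℂ) • (b * eisensteinG 2 ^ n)) (P + (-1 : ℂ) • R) := h.add (hRq.smul _)
      have hmem : f + (-1 : ℂ) • (b * eisensteinG 2 ^ n) ∈ quasimodularSpace (m + 2 * n) :=
        ⟨N, hN, _, hsub⟩
      have h1 := ih _ _ _ (by
        rw [degree_lt_iff_coeff_zero]
        intro i hi
        rw [coeff_add, coeff_smul]
        rcases hi.eq_or_lt with rfl | hi
        · rw [hRn]; simp [ha]
        · rw [coeff_eq_zero_of_natDegree_lt (lt_of_le_of_lt hn hi),
            coeff_eq_zero_of_natDegree_lt (lt_of_le_of_lt hRd hi)]; simp) hsub hmem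
      have h2 := add_mem h1 (AlgHom.mem_range_self evalG2
        (monomial n (Tower.of modularSpace m ⟨b, hbM⟩)))
      rw [← hprod, ← map_add] at h2
      convert! h2 using 3
      ext z
      simp

theorem evalG2_surjective : Function.Surjective evalG2 := by
  intro x
  change x ∈ evalG2.range
  induction x using Tower.induction with
  | h0 => exact zero_mem _
  | hof k f =>
    obtain ⟨f, hf⟩ := f
    obtain ⟨N, hN, P, hP⟩ := id hf
    refine of_mem_range_evalG2 hN (P.natDegree + 1) k f P ?_ hP hf
    exact lt_of_le_of_lt degree_le_natDegree (by exact_mod_cast Nat.lt_succ_self _)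
  | hadd a b ha hb => exact add_mem ha hb

/-- The expansion `f = ∑ i, a_i(f) G_2^i` of quasimodular forms with modular coefficients: the
inverse of the evaluation of polynomials at `G_2`. -/
noncomputable def expansion : QMTower ≃ₐ[ℂ] MTower[X] :=
  (AlgEquiv.ofBijective evalG2 ⟨evalG2_injective, evalG2_surjective⟩).symm

/-! ### The action of `GL_2^+(ℚ)` -/

/-- A rational matrix as a real matrix. -/
noncomputable def toReal (α : GL(2, ℚ)⁺) : GL (Fin 2) ℝ :=
  Matrix.GeneralLinearGroup.map (Rat.castHom ℝ) (α : GL (Fin 2) ℚ)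

theorem toReal_det_pos (α : GL(2, ℚ)⁺) : 0 < (toReal α).det.val := by
  have h : (toReal α).det.val = ((α : GL (Fin 2) ℚ).det.val : ℝ) :=
    congrArg Units.val (Matrix.GeneralLinearGroup.map_det (Rat.castHom ℝ) (α : GL (Fin 2) ℚ))
  rw [h]
  exact_mod_cast α.2

/-- `(f|_k α)(z) = (cz+d)^(-k) f((az+b)/(cz+d))`, without a determinant factor. -/
noncomputable def slashQ (k : ℤ) (α : GL(2, ℚ)⁺) (f : ℍ → ℂ) (z : ℍ) : ℂ :=
  denom (toReal α) z ^ (-k) * f (toReal α • z)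

theorem slashQ_eq (k : ℤ) (α : GL(2, ℚ)⁺) (f : ℍ → ℂ) :
    slashQ k α f = (((toReal α).det.val : ℂ) ^ (k - 1))⁻¹ • (f ∣[k] toReal α) := by
  ext z
  have h0 := toReal_det_pos α
  have hσ : σ (toReal α) = .refl ℝ ℂ := by rw [σ, if_pos h0]
  have h1 : (((toReal α).det.val : ℂ) ^ (k - 1)) ≠ 0 :=
    zpow_ne_zero _ (by exact_mod_cast h0.ne')
  rw [Pi.smul_apply, ModularForm.slash_apply, hσ, abs_of_pos h0, slashQ, smul_eq_mul]
  change _ = _ * (f (toReal α • z) * _ * _)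
  field_simp

open ConjAct Pointwise in
theorem IsModular.slashQ {k : ℤ} {f : ℍ → ℂ} (hf : IsModular k f) (α : GL(2, ℚ)⁺) :
    IsModular k (slashQ k α f) := by
  rw [slashQ_eq]
  refine IsModular.smul _ ?_
  obtain ⟨M, hM, g, rfl⟩ := hf
  have : NeZero M := ⟨hM⟩
  obtain ⟨N, hN, h⟩ := exists_Gamma_le_conj' (α : GL (Fin 2) ℚ) M
  have : NeZero N := ⟨hN⟩
  change toConjAct (toReal α) • _ ≤ _ at h
  have hle : (Gamma N).map (Matrix.SpecialLinearGroup.mapGL ℝ) ≤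
      toConjAct (toReal α)⁻¹ • (Gamma M).map (Matrix.SpecialLinearGroup.mapGL ℝ) := by
    rw [map_inv, ← Subgroup.pointwise_smul_subset_iff]; exact h
  set t := ModularForm.translate g (toReal α) with ht
  have e : ⇑g ∣[k] toReal α = ⇑t := rfl
  refine ⟨N, hN, ⟨⟨⇑t, fun γ hγ => t.slash_action_eq' γ (hle hγ)⟩, t.holo', ?_⟩, rfl⟩
  intro c hc
  exact t.bdd_at_cusps' (hc.mono hle)

theorem slashQ_mul (k l : ℤ) (α : GL(2, ℚ)⁺) (f g : ℍ → ℂ) :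
    slashQ (k + l) α (f * g) = slashQ k α f * slashQ l α g := by
  ext z
  rw [Pi.mul_apply, slashQ, slashQ, slashQ, neg_add, zpow_add₀ (denom_ne_zero _ z), Pi.mul_apply]
  ring

/-- The operation `f ↦ f|_k α` on modular forms of weight `k` and arbitrary level. -/
noncomputable def slashLin (α : GL(2, ℚ)⁺) (k : ℕ) : modularSpace k →ₗ[ℂ] modularSpace k where
  toFun f := ⟨slashQ k α f, IsModular.slashQ f.2 α⟩
  map_add' _ _ := Subtype.ext <| funext fun _ => mul_add _ _ _
  map_smul' _ _ := Subtype.ext <| funext fun _ => mul_left_comm _ _ _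

/-- The operation `f ↦ f|α` on the modular tower, equal to `f ↦ f|_k α` in weight `k`. -/
noncomputable def mSlash (α : GL(2, ℚ)⁺) : MTower →ₐ[ℂ] MTower :=
  Tower.map (slashLin α)
    (by ext z; simp [slashLin, slashQ])
    (by
      intro i j a b
      change slashQ ((i + j : ℕ) : ℤ) α _ = slashQ i α a * slashQ j α b
      rw [Nat.cast_add, slashQ_mul])

theorem mSlash_of (α : GL(2, ℚ)⁺) (k : ℕ) (f : modularSpace k) :
    mSlash α (Tower.of modularSpace k f) = Tower.of modularSpace k (slashLin α k f) :=
  Tower.map_of _ _ _ k f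

/-- The operation `f || α = ∑ i, (a_i(f)|α) G_2^i` on the quasimodular tower, where
`f = ∑ i, a_i(f) G_2^i` with modular coefficients. -/
noncomputable def dslash (α : GL(2, ℚ)⁺) : QMTower →ₐ[ℂ] QMTower :=
  evalG2.comp ((Polynomial.mapAlgHom (mSlash α)).comp expansion.toAlgHom)

theorem evalG2_expansion (f : QMTower) : evalG2 (expansion f) = f :=
  (AlgEquiv.ofBijective evalG2 ⟨evalG2_injective, evalG2_surjective⟩).apply_symm_apply f

theorem evalG2_X : evalG2 X = G2 := by
  change eval₂ (incl : MTower →+* QMTower) G2 _ = _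
  rw [eval₂_X]

theorem evalG2_C (a : MTower) : evalG2 (C a) = incl a := by
  change eval₂ (incl : MTower →+* QMTower) G2 _ = _
  rw [eval₂_C]; rfl

/-- The modular coefficients of an element of the quasimodular tower in its expansion. -/
noncomputable def coef (i : ℕ) (f : QMTower) : MTower := (expansion f).coeff i

theorem eq_sum_coef (f : QMTower) :
    f = ∑ i ∈ (expansion f).support, incl (coef i f) * G2 ^ i := by
  conv_lhs => rw [← evalG2_expansion f]
  exact evalG2_eq_sum _

theorem dslash_eq_sum (α : GL(2, ℚ)⁺) (f : QMTower) :
    dslash α f = ∑ i ∈ (expansion f).support, incl (mSlash α (coef i f)) * G2 ^ i := by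
  change evalG2 ((expansion f).map (mSlash α : MTower →+* MTower)) = _
  conv_lhs => rw [(expansion f).as_sum_support_C_mul_X_pow]
  rw [Polynomial.map_sum, map_sum]
  refine Finset.sum_congr rfl fun i _ => ?_
  rw [Polynomial.map_mul, Polynomial.map_pow, map_C, map_X, map_mul, map_pow, evalG2_C, evalG2_X]
  rfl

/-! ### The operators -/

/-- The derivation `∑ i, a_i G_2^i ↦ ∑ i, i a_i G_2^(i-1)`. -/
noncomputable def dG2 : QMTower →ₗ[ℂ] QMTower :=
  evalG2.toLinearMap ∘ₗ (Polynomial.derivative.restrictScalars ℂ) ∘ₗ expansion.toLinearMap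

/-- `D(f) = -1/(8πi) ∑ i, i a_i(f) G_2^(i-1) G_2'`. -/
noncomputable def opD : QMTower →ₗ[ℂ] QMTower :=
  (-(1 / (8 * Real.pi * Complex.I)) : ℂ) • LinearMap.mulRight ℂ G2' ∘ₗ dG2

/-- `W_k(f) = ∑ i, i a_i(f) G_2^(i+k-2)` for `k ≥ 1`. -/
noncomputable def opW (k : ℕ+) : QMTower →ₗ[ℂ] QMTower :=
  LinearMap.mulLeft ℂ (G2 ^ ((k : ℕ) - 1)) ∘ₗ dG2

theorem dG2_eq_sum (f : QMTower) :
    dG2 f = ∑ i ∈ (expansion f).support, (i : ℂ) • (incl (coef i f) * G2 ^ (i - 1)) := by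
  change evalG2 (derivative (expansion f)) = _
  rw [derivative_apply, Polynomial.sum, map_sum]
  refine Finset.sum_congr rfl fun i _ => ?_
  rw [map_mul, map_pow, evalG2_C, evalG2_X, map_mul, map_natCast, coef, Nat.cast_smul_eq_nsmul,
    nsmul_eq_mul]
  ring

theorem opD_eq_sum (f : QMTower) : opD f = (-(1 / (8 * Real.pi * Complex.I)) : ℂ) •
    ∑ i ∈ (expansion f).support, (i : ℂ) • (incl (coef i f) * G2 ^ (i - 1) * G2') := by
  change (-(1 / (8 * Real.pi * Complex.I)) : ℂ) • (dG2 f * G2') = _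
  rw [dG2_eq_sum, Finset.sum_mul]
  simp_rw [smul_mul_assoc]

theorem opW_eq_sum (k : ℕ+) (f : QMTower) : opW k f =
    ∑ i ∈ (expansion f).support, (i : ℂ) • (incl (coef i f) * G2 ^ (i + (k : ℕ) - 2)) := by
  change _ * dG2 f = _
  rw [dG2_eq_sum, Finset.mul_sum]
  refine Finset.sum_congr rfl fun i _ => ?_
  rcases Nat.eq_zero_or_pos i with rfl | hi
  · simp
  · have hk := k.pos
    rw [mul_smul_comm, mul_left_comm, ← pow_add]
    congr 4
    omega

/-- `E(f) = G_4 f`. -/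
noncomputable def opE : QMTower →ₗ[ℂ] QMTower := LinearMap.mulLeft ℂ (incl G4)

/-- `T_k^l = E^l W_k`. -/
noncomputable def opT (k : ℕ+) (l : ℕ) : QMTower →ₗ[ℂ] QMTower := opE ^ l * opW k

/-- `ν_α^(m) = -5/24 (G_4^m|α - G_4^m)`. -/
noncomputable def nu (m : ℕ+) (α : GL(2, ℚ)⁺) : MTower :=
  (-(5 / 24) : ℂ) • (mSlash α (G4 ^ (m : ℕ)) - G4 ^ (m : ℕ))

/-! ### Quasimodular Hecke operators -/

/-- `SL_2(ℤ)` inside `GL_2^+(ℚ)`. -/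
def toQ : SL(2, ℤ) →* GL(2, ℚ)⁺ :=
  Matrix.SpecialLinearGroup.toGLPos.comp (Matrix.SpecialLinearGroup.map (Int.castRingHom ℚ))

/-- `Γ(N)` as a subgroup of `GL_2^+(ℚ)`. -/
def GammaQ (N : ℕ) : Subgroup GL(2, ℚ)⁺ := (Gamma N).map toQ

/-- The quasimodular Hecke operators of level `Γ = Γ(N)`: functions `F` on `Γ \ GL_2^+(ℚ)` with
finite support, values in the quasimodular tower, and `F_{αγ} = F_α || γ` for `γ` in `Γ`. -/
def Q (N : ℕ) : Submodule ℂ (GL(2, ℚ)⁺ → QMTower) where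
  carrier := {F | (∀ γ ∈ GammaQ N, ∀ α, F (γ * α) = F α) ∧
    (Quotient.mk (QuotientGroup.rightRel (GammaQ N)) '' Function.support F).Finite ∧
    ∀ γ ∈ GammaQ N, ∀ α, F (α * γ) = dslash γ (F α)}
  add_mem' := by
    rintro F G ⟨h1, h2, h3⟩ ⟨h1', h2', h3'⟩
    refine ⟨fun γ hγ α => ?_, ?_, fun γ hγ α => ?_⟩
    · rw [Pi.add_apply, Pi.add_apply, h1 γ hγ, h1' γ hγ]
    · refine (h2.union h2').subset ?_
      rw [← Set.image_union]
      exact Set.image_mono (Function.support_add F G)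
    · rw [Pi.add_apply, Pi.add_apply, h3 γ hγ, h3' γ hγ, map_add]
  zero_mem' := by
    refine ⟨fun _ _ _ => rfl, ?_, fun γ _ _ => (map_zero (dslash γ)).symm⟩
    rw [Function.support_zero, Set.image_empty]
    exact Set.finite_empty
  smul_mem' := by
    rintro c F ⟨h1, h2, h3⟩
    refine ⟨fun γ hγ α => ?_, h2.subset (Set.image_mono (Function.support_const_smul_subset c F)),
      fun γ hγ α => ?_⟩
    · rw [Pi.smul_apply, Pi.smul_apply, h1 γ hγ]
    · rw [Pi.smul_apply, Pi.smul_apply, h3 γ hγ, map_smul]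

/-- The product `(F ∗ʳ G)_α = ∑ β ∈ Γ \ SL_2(ℤ), F_β (G_{αβ⁻¹} || β)` of level `Γ = Γ(N)`. For
`F`, `G` in `Q N` the summand does not depend on the representative of the coset of `β`. -/
noncomputable def starR (N : ℕ) (F G : GL(2, ℚ)⁺ → QMTower) (α : GL(2, ℚ)⁺) : QMTower :=
  ∑ᶠ q : Quotient (QuotientGroup.rightRel (Gamma N)),
    F (toQ q.out) * dslash (toQ q.out) (G (α * (toQ q.out)⁻¹))

end QuasimodularHecke

open QuasimodularHecke
open scoped MatrixGroups TensorProduct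

namespace QuasimodularHecke

open UpperHalfPlane Polynomial CongruenceSubgroup
open scoped MatrixGroups ModularForm Manifold DirectSum TensorProduct

/-! ### The derivative of `G_2` -/

/-! The quasimodular tower is the polynomial ring `MTower[X]` with `X` standing for $G_2$. Write
$\partial$ for the derivation `dG2` $=d/dG_2$. Every generator $g$ then acts on the component at
$\alpha$ by one formula (`genAct`): $f\mapsto\sigma_g\,\partial f+\nu_g(\alpha)f$, a vector field
plus multiplication by a modular potential. For $T_k^l$ this reads $\sigma=G_4^lG_2^{k-1}$, $\nu=0$,
and for $\phi^{(m)}$ it reads $\sigma=0$, $\nu=\nu^{(m)}$. For $D$ it rests on Ramanujan's identity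
$G_2'=2\pi i(-2G_2^2+\frac56G_4)$ (`eisensteinG2'_ramanujan`), which gives
$\sigma_D=\frac12G_2^2-\frac5{24}G_4$ and $\nu=0$.

Three facts do the rest. The operation $||\alpha$ changes only the modular coefficients, so it is a
ring map commuting with $\partial$. The symbols $\sigma_g$ involve only $G_2$ and $G_4$, so
$||\gamma$ fixes them for $\gamma\in SL_2(\mathbb Z)$. The potential satisfies
$\nu_{\gamma\alpha}=\nu_\alpha$, $\nu_{\alpha\gamma}=\nu_\alpha|\gamma$ and $\nu_\gamma=0$ for
$\gamma\in SL_2(\mathbb Z)$.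

Hence the operators preserve $\mathcal Q(\Gamma)$ and obey the Leibniz rule for $*^r$ (`genAct_mul`,
`genEnd_mul`). In the summand $F^1_\beta\cdot(F^2_{\alpha\beta^{-1}}||\beta)$ the derivation splits,
and the potential $\nu_\alpha=\nu_{\alpha\beta^{-1}}|\beta$ falls on the second factor, while
$\nu_\beta=0$ on the first. The commutator of two generators is the vector field
$(\sigma_g\partial\sigma_h-\sigma_h\partial\sigma_g)\partial$ (`genAct_commutator`), so the
relations of $\mathcal L$ become identities between polynomials in $G_2$ and $G_4$
(`freeAction_relator`). Finally the Leibniz rule passes from generators to the free Lie algebra, to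
$\mathcal L$, and to $\mathcal U(\mathcal L)$, whose coproduct is determined by primitivity
(`hopfAction_tensorAction`).

Well-definedness and associativity of $*^r$ come from reindexing $\beta\mapsto\beta\delta$ on the
finite set $\Gamma\backslash SL_2(\mathbb Z)$. -/

/-- The expansion forces period 1, so $f$ factors through $q$ as a function analytic at $q=0$ with
value $c_0$ there, and $q\to0$ at the cusp. -/
theorem tendsto_of_hasSum_qExpansion {f : ℍ → ℂ} (hf : MDiff f) (hb : IsBoundedAtImInfty f)
    {c : ℕ → ℂ}
    (hc : ∀ τ : ℍ, HasSum (fun m ↦ c m • Function.Periodic.qParam 1 τ ^ m) (f τ)) :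
    Filter.Tendsto f atImInfty (nhds (c 0)) := by
  have hper : Function.Periodic (f ∘ ofComplex) (1 : ℝ) := by
    intro w
    simp only [Function.comp_apply, Complex.ofReal_one]
    by_cases hw : 0 < w.im
    · have hw' : 0 < (w + 1).im := by simpa using hw
      rw [ofComplex_apply_of_im_pos hw, ofComplex_apply_of_im_pos hw']
      have h1 := hc ⟨w + 1, hw'⟩
      have h2 : Function.Periodic.qParam 1 ((⟨w + 1, hw'⟩ : ℍ) : ℂ) =
          Function.Periodic.qParam 1 ((⟨w, hw⟩ : ℍ) : ℂ) := by
        simp [Function.Periodic.qParam, mul_add, Complex.exp_add, Complex.exp_two_pi_mul_I]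
      rw [h2] at h1
      exact h1.unique (hc _)
    -- Off the upper half plane `ofComplex` is a constant default, so periodicity is trivial.
    · rw [ofComplex_apply_of_im_nonpos (not_lt.mp hw),
        ofComplex_apply_of_im_nonpos (by simpa using hw)]
  have han := analyticAt_cuspFunction_zero one_pos hper hf hb
  have h0 : c 0 = cuspFunction 1 f 0 := by
    simpa using (hasFPowerSeriesOnBall_cuspFunction one_pos han hc).hasFPowerSeriesAt.coeff_zero 0
  have hcomp : (cuspFunction 1 f ∘ fun τ ↦ Function.Periodic.qParam 1 τ : ℍ → ℂ) = f := by
    funext τ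
    simpa using eq_cuspFunction τ one_ne_zero hper
  rw [h0]
  simpa [hcomp] using han.continuousAt.tendsto.comp (qParam_tendsto_atImInfty one_pos)

theorem tendsto_eisensteinG_two :
    Filter.Tendsto (eisensteinG 2) atImInfty (nhds (-1 / 24)) := by
  have h : Filter.Tendsto EisensteinSeries.E2 atImInfty (nhds 1) := by
    refine tendsto_of_hasSum_qExpansion (c := fun m : ℕ ↦
      (if m = 0 then 1 else -24 * ArithmeticFunction.sigma 1 m : ℂ)) E2_mdifferentiable
      EisensteinSeries.isBoundedAtImInfty_E2 fun τ ↦ ?_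
    simpa only [Function.Periodic.qParam, Complex.ofReal_one, div_one] using
      EisensteinSeries.hasSum_qExpansion_E2 (z := τ)
  rw [eisensteinG_two]
  simpa using! h.const_smul (-1 / 24 : ℂ)

theorem tendsto_E₄ : Filter.Tendsto ModularForm.E₄ atImInfty (nhds 1) := by
  have h := tendsto_of_hasSum_qExpansion (f := ModularForm.E₄)
    (c := fun m ↦ (qExpansion 1 ModularForm.E₄).coeff m) ModularForm.E₄.holo'
    (ModularFormClass.bdd_at_infty _) fun τ ↦
    ModularForm.hasSum_qExpansion (h := 1) ModularForm.E₄ one_pos (by simp) τ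
  rwa [EisensteinSeries.E_qExpansion_coeff_zero _ (by decide)] at h

/-- Cauchy's estimate for $f-c$ on discs of radius 1. It gives $G_2'$ the constant term 0. -/
theorem tendsto_deriv_atImInfty {f : ℍ → ℂ} (hf : MDiff f) {c : ℂ}
    (h : Filter.Tendsto f atImInfty (nhds c)) :
    Filter.Tendsto (fun z : ℍ ↦ deriv (f ∘ ofComplex) z) atImInfty (nhds 0) := by
  have hd := UpperHalfPlane.mdifferentiable_iff.mp hf
  rw [Metric.tendsto_nhds] at h ⊢
  intro ε hε
  have h' := h (ε / 2) (half_pos hε)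
  rw [Filter.Eventually, atImInfty_mem] at h' ⊢
  obtain ⟨A, hA⟩ := h'
  -- The unit disc about such a $z$ stays in the upper half plane and in the region where
  -- $|f-c|<\varepsilon/2$.
  refine ⟨max A 0 + 2, fun z hz => ?_⟩
  have him : ∀ w ∈ Metric.closedBall (z : ℂ) 1, max A 0 + 1 ≤ w.im := by
    intro w hw
    rw [mem_closedBall_iff_norm] at hw
    have h1 := (Complex.abs_im_le_norm (w - z)).trans hw
    rw [Complex.sub_im, abs_le] at h1
    have : (z : ℂ).im = z.im := rfl
    linarith [h1.1]
  have key : ‖deriv (fun w => (f ∘ ofComplex) w - c) (z : ℂ)‖ ≤ ε / 2 / 1 := by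
    refine Complex.norm_deriv_le_of_forall_mem_sphere_norm_le one_pos ?_ ?_
    · refine DifferentiableOn.diffContOnCl_ball (U := upperHalfPlaneSet) (hd.sub_const c) ?_
      intro w hw
      exact lt_of_lt_of_le (by positivity) (him w hw)
    · intro w hw
      have h1 := him w (Metric.sphere_subset_closedBall hw)
      have h2 : 0 < w.im := lt_of_lt_of_le (by positivity) h1
      rw [Function.comp_apply, ofComplex_apply_of_im_pos h2, ← dist_eq_norm]
      refine (hA _ ?_).le
      change A ≤ w.im
      linarith [le_max_left A 0]
  rw [deriv_sub_const, div_one] at key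
  change dist _ _ < ε
  rw [dist_zero_right]
  exact key.trans_lt (half_lt_self hε)

/-- Since $4\pi i$ times `g2const` is $-1$, the correction terms of $4\pi i\,G_2^2$ cancel those of
$G_2'$. -/
theorem eisensteinG2'_add_slash (γ : SL(2, ℤ)) :
    (eisensteinG2' + (4 * Real.pi * Complex.I : ℂ) • eisensteinG 2 ^ 2) ∣[(4 : ℤ)] γ =
      eisensteinG2' + (4 * Real.pi * Complex.I : ℂ) • eisensteinG 2 ^ 2 := by
  ext z
  rw [SlashAction.add_slash, ModularForm.SL_smul_slash, pow_two, show (4 : ℤ) = 2 + 2 by norm_num,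
    ModularForm.mul_slash_SL2, eisensteinG_two_slash]
  simp only [Pi.add_apply, Pi.smul_apply, Pi.mul_apply, smul_eq_mul]
  rw [show (2 + 2 : ℤ) = 4 by norm_num, eisensteinG2'_slash, g2const]
  have h : (Real.pi : ℂ) ≠ 0 := by exact_mod_cast Real.pi_ne_zero
  field_simp
  linear_combination (8 * eisensteinG 2 z * cocyc γ z * Real.pi +
    Complex.I * cocyc γ z ^ 2) * Complex.I_sq

/-- $G_2'+4\pi iG_2^2$ is a modular form of weight 4 and level one, a space spanned by $E_4$. Limits
at the cusp fix the scalar. -/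
theorem eisensteinG2'_ramanujan : eisensteinG2' = (2 * Real.pi * Complex.I : ℂ) •
    ((-2 : ℂ) • eisensteinG 2 ^ 2 + (5 / 6 : ℂ) • eisensteinG 4) := by
  set f : ℍ → ℂ := eisensteinG2' + (4 * Real.pi * Complex.I : ℂ) • eisensteinG 2 ^ 2 with hf
  have hm : MDiff eisensteinG2' := isQuasimodularWith_eisensteinG2'.holo
  obtain ⟨g, hg⟩ : ∃ g : ModularForm 𝒮ℒ 4, ⇑g = f := by
    have h1 : ∃ g : ModularForm ((Gamma 1).map (Matrix.SpecialLinearGroup.mapGL ℝ)) 4, ⇑g = f := by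
      refine modularForm_iff.mpr ⟨hm.add (mdiff_smul _ (mdiff_eisensteinG_two.pow 2)),
        fun γ _ => eisensteinG2'_add_slash γ, fun δ => ?_⟩
      rw [eisensteinG2'_add_slash, pow_two]
      exact bdd_add bdd_eisensteinG2'
        (bdd_smul _ (bdd_mul bdd_eisensteinG_two bdd_eisensteinG_two))
    rw [Gamma_one_coe_eq_SL] at h1
    exact h1
  obtain ⟨c, hc⟩ := (finrank_eq_one_iff_of_nonzero' ModularForm.E₄
    (EisensteinSeries.E_ne_zero _ (by decide))).mp
    (Module.rank_eq_one_iff_finrank_eq_one.mp ModularForm.levelOne_weight_four_rank_one) g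
  have hc' : f = c • ⇑ModularForm.E₄ := by rw [← hg, ← hc]; rfl
  have t1 : Filter.Tendsto f atImInfty (nhds c) := by
    rw [hc']; simpa using! tendsto_E₄.const_smul c
  have t2 : Filter.Tendsto f atImInfty
      (nhds (0 + (4 * Real.pi * Complex.I : ℂ) • (-1 / 24 : ℂ) ^ 2)) :=
    (tendsto_deriv_atImInfty mdiff_eisensteinG_two tendsto_eisensteinG_two).add
      ((tendsto_eisensteinG_two.pow 2).const_smul _)
  -- Thus $c=4\pi i/24^2$, and $E_4=240\,G_4$ turns this into $2\pi i\cdot\frac56$ as coefficient of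
  -- $G_4$.
  have hcv := tendsto_nhds_unique t1 t2
  rw [eq_sub_of_add_eq hf.symm, hc', hcv, eisensteinG_four]
  ext z
  simp only [Pi.add_apply, Pi.sub_apply, Pi.smul_apply, Pi.pow_apply, smul_eq_mul]
  ring

theorem G2'_eq : G2' = (2 * Real.pi * Complex.I : ℂ) •
    ((-2 : ℂ) • G2 ^ 2 + (5 / 6 : ℂ) • incl G4) := by
  obtain ⟨h, h2⟩ := G2_pow 2
  rw [h2, G4, incl_of]
  change _ = (2 * Real.pi * Complex.I : ℂ) • ((-2 : ℂ) • Tower.of quasimodularSpace 4 _ + _)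
  rw [← map_smul, ← map_smul, ← map_add, ← map_smul]
  exact congrArg (Tower.of quasimodularSpace 4) (Subtype.ext eisensteinG2'_ramanujan)

/-! ### The action of `GL_2^+(ℚ)` on the towers -/

theorem toReal_mul (α β : GL(2, ℚ)⁺) : toReal (α * β) = toReal α * toReal β :=
  map_mul (Matrix.GeneralLinearGroup.map (Rat.castHom ℝ)) _ _

theorem slashQ_mul_left (k : ℤ) (α β : GL(2, ℚ)⁺) (f : ℍ → ℂ) :
    slashQ k (α * β) f = slashQ k β (slashQ k α f) := by
  ext z
  have hσ : σ (toReal α) = .refl ℝ ℂ := by rw [σ, if_pos (toReal_det_pos α)]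
  have hσ' : σ (toReal β) = .refl ℝ ℂ := by rw [σ, if_pos (toReal_det_pos β)]
  have hd := denom_cocycle_σ (toReal α) (toReal β) z
  rw [slashQ, slashQ, slashQ, toReal_mul, mul_smul, hd, hσ']
  simp only [ContinuousAlgEquiv.refl_apply]
  rw [mul_zpow]
  ring

theorem toReal_toQ (γ : SL(2, ℤ)) : toReal (toQ γ) = Matrix.SpecialLinearGroup.mapGL ℝ γ := by
  ext i j
  simp [toReal, toQ]

theorem slashQ_toQ (k : ℤ) (γ : SL(2, ℤ)) (f : ℍ → ℂ) : slashQ k (toQ γ) f = f ∣[k] γ := by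
  ext z
  rw [slashQ, toReal_toQ, ModularForm.SL_slash_apply, mul_comm]
  rfl

theorem mSlash_mul (α β : GL(2, ℚ)⁺) (f : MTower) :
    mSlash (α * β) f = mSlash β (mSlash α f) := by
  induction f using Tower.induction with
  | h0 => simp
  | hof k a =>
    rw [mSlash_of, mSlash_of, mSlash_of]
    exact congrArg (Tower.of modularSpace k) (Subtype.ext (slashQ_mul_left k α β a))
  | hadd a b ha hb => simp only [map_add, ha, hb]

theorem mSlash_toQ_G4 (γ : SL(2, ℤ)) : mSlash (toQ γ) G4 = G4 := by
  rw [G4, mSlash_of]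
  refine congrArg (Tower.of modularSpace 4) (Subtype.ext ?_)
  change slashQ ((4 : ℕ) : ℤ) (toQ γ) (eisensteinG 4) = eisensteinG 4
  rw [slashQ_toQ, eisensteinG_four, ModularForm.SL_smul_slash]
  congr 1
  exact ModularForm.E₄.slash_action_eq' _ ⟨γ, rfl⟩

theorem expansion_evalG2 (p : MTower[X]) : expansion (evalG2 p) = p :=
  (AlgEquiv.ofBijective evalG2 ⟨evalG2_injective, evalG2_surjective⟩).symm_apply_apply p

/-- This and `dG2_evalG2` move questions about the tower to polynomials, where one operation touches
only coefficients and the other only the variable. -/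
theorem dslash_evalG2 (α : GL(2, ℚ)⁺) (p : MTower[X]) :
    dslash α (evalG2 p) = evalG2 (p.map (mSlash α : MTower →+* MTower)) := by
  change evalG2 ((expansion (evalG2 p)).map (mSlash α : MTower →+* MTower)) = _
  rw [expansion_evalG2]

theorem dslash_mul (α β : GL(2, ℚ)⁺) (f : QMTower) :
    dslash (α * β) f = dslash β (dslash α f) := by
  obtain ⟨p, rfl⟩ := evalG2_surjective f
  rw [dslash_evalG2, dslash_evalG2, dslash_evalG2, Polynomial.map_map]
  congr 2
  ext1 a
  exact mSlash_mul α β a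

theorem dslash_incl (α : GL(2, ℚ)⁺) (a : MTower) : dslash α (incl a) = incl (mSlash α a) := by
  rw [← evalG2_C, dslash_evalG2, map_C, evalG2_C]
  rfl

/-- $||\alpha$ treats $G_2$ as an inert variable, in contrast to the usual slash operator of weight
2, for which $G_2$ acquires a correction term. -/
theorem dslash_G2 (α : GL(2, ℚ)⁺) : dslash α G2 = G2 := by
  rw [← evalG2_X, dslash_evalG2, map_X]

/-! ### The derivation with respect to `G_2` -/

theorem dG2_evalG2 (p : MTower[X]) : dG2 (evalG2 p) = evalG2 (derivative p) := by
  change evalG2 (derivative (expansion (evalG2 p))) = _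
  rw [expansion_evalG2]

theorem dG2_mul (f g : QMTower) : dG2 (f * g) = dG2 f * g + f * dG2 g := by
  obtain ⟨p, rfl⟩ := evalG2_surjective f
  obtain ⟨q, rfl⟩ := evalG2_surjective g
  rw [← map_mul, dG2_evalG2, dG2_evalG2, dG2_evalG2, derivative_mul, map_add, map_mul, map_mul]

theorem dG2_incl (a : MTower) : dG2 (incl a) = 0 := by
  rw [← evalG2_C, dG2_evalG2, derivative_C, map_zero]

theorem dG2_G2_pow (n : ℕ) : dG2 (G2 ^ n) = (n : ℂ) • G2 ^ (n - 1) := by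
  rw [← evalG2_X, ← map_pow, dG2_evalG2, derivative_X_pow, map_mul, map_pow, evalG2_C,
    map_natCast, Nat.cast_smul_eq_nsmul, nsmul_eq_mul]

theorem dG2_dslash (α : GL(2, ℚ)⁺) (f : QMTower) : dG2 (dslash α f) = dslash α (dG2 f) := by
  obtain ⟨p, rfl⟩ := evalG2_surjective f
  rw [dslash_evalG2, dG2_evalG2, dG2_evalG2, dslash_evalG2, derivative_map]

/-! ### The generators as first order differential operators -/

namespace Gen

/-- The coefficient of the derivation with respect to `G_2` in the operator of a generator. -/
noncomputable def symbol : Gen → QMTower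
  | D => (1 / 2 : ℂ) • G2 ^ 2 - (5 / 24 : ℂ) • incl G4
  | T k l => incl G4 ^ l * G2 ^ ((k : ℕ) - 1)
  | φ _ => 0

/-- The multiplication part of the operator of a generator at `α`. -/
noncomputable def potential : Gen → GL(2, ℚ)⁺ → MTower
  | φ m => nu m
  | _ => 0

end Gen

theorem opD_eq (f : QMTower) : opD f = Gen.D.symbol * dG2 f := by
  change (-(1 / (8 * Real.pi * Complex.I)) : ℂ) • (dG2 f * G2') = _
  have h : (Real.pi : ℂ) ≠ 0 := by exact_mod_cast Real.pi_ne_zero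
  rw [G2'_eq, mul_comm (dG2 f), ← smul_mul_assoc, Gen.symbol, smul_smul]
  -- The normalization of $D$ cancels the $2\pi i$ of Ramanujan's identity, which leaves
  -- $-\frac14(-2G_2^2+\frac56G_4)$.
  have hc : -(1 / (8 * Real.pi * Complex.I)) * (2 * Real.pi * Complex.I) = (-1 / 4 : ℂ) := by
    field_simp
    norm_num
  rw [hc]
  algebra

theorem opT_eq (k : ℕ+) (l : ℕ) (f : QMTower) : opT k l f = (Gen.T k l).symbol * dG2 f := by
  have h : ∀ x, (opE ^ l) x = incl G4 ^ l * x := by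
    intro x
    induction l with
    | zero => simp
    | succ l ih =>
      rw [pow_succ', Module.End.mul_apply, ih, pow_succ', mul_assoc]
      rfl
  change (opE ^ l) (G2 ^ ((k : ℕ) - 1) * dG2 f) = _
  rw [h, Gen.symbol, mul_assoc]

theorem dslash_toQ_symbol (γ : SL(2, ℤ)) (g : Gen) : dslash (toQ γ) g.symbol = g.symbol := by
  cases g <;>
    simp only [Gen.symbol, map_sub, map_smul, map_mul, map_pow, map_zero, dslash_G2, dslash_incl,
      mSlash_toQ_G4]

/-- Up to a scalar, $\nu^{(m)}$ is the coboundary of $G_4^m$, which has level one. This yields left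
invariance here, and below right equivariance and vanishing on $SL_2(\mathbb Z)$. -/
theorem nu_toQ_mul (m : ℕ+) (γ : SL(2, ℤ)) (α : GL(2, ℚ)⁺) : nu m (toQ γ * α) = nu m α := by
  rw [nu, nu, mSlash_mul, map_pow (mSlash (toQ γ)), mSlash_toQ_G4]

theorem nu_mul_toQ (m : ℕ+) (α : GL(2, ℚ)⁺) (γ : SL(2, ℤ)) :
    nu m (α * toQ γ) = mSlash (toQ γ) (nu m α) := by
  rw [nu, nu, mSlash_mul, map_smul, map_sub, map_pow (mSlash (toQ γ)) G4, mSlash_toQ_G4]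

theorem potential_toQ_mul (g : Gen) (γ : SL(2, ℤ)) (α : GL(2, ℚ)⁺) :
    g.potential (toQ γ * α) = g.potential α := by
  cases g with
  | φ m => exact nu_toQ_mul m γ α
  | _ => rfl

theorem potential_mul_toQ (g : Gen) (α : GL(2, ℚ)⁺) (γ : SL(2, ℤ)) :
    g.potential (α * toQ γ) = mSlash (toQ γ) (g.potential α) := by
  cases g with
  | φ m => exact nu_mul_toQ m α γ
  | _ => exact (map_zero (mSlash (toQ γ))).symm

theorem potential_toQ (g : Gen) (γ : SL(2, ℤ)) : g.potential (toQ γ) = 0 := by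
  cases g with
  | φ m => rw [Gen.potential, nu, map_pow, mSlash_toQ_G4, sub_self, smul_zero]
  | _ => rfl

/-- The operator of a generator on the component at `α` of a quasimodular Hecke operator. -/
noncomputable def genAct (g : Gen) (α : GL(2, ℚ)⁺) : QMTower →ₗ[ℂ] QMTower :=
  LinearMap.mulLeft ℂ g.symbol ∘ₗ dG2 + LinearMap.mulLeft ℂ (incl (g.potential α))

theorem genAct_apply (g : Gen) (α : GL(2, ℚ)⁺) (f : QMTower) :
    genAct g α f = g.symbol * dG2 f + incl (g.potential α) * f := rfl

theorem genAct_toQ_mul (g : Gen) (γ : SL(2, ℤ)) (α : GL(2, ℚ)⁺) :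
    genAct g (toQ γ * α) = genAct g α := by
  rw [genAct, genAct, potential_toQ_mul]

theorem genAct_mul_toQ (g : Gen) (α : GL(2, ℚ)⁺) (γ : SL(2, ℤ)) (f : QMTower) :
    genAct g (α * toQ γ) (dslash (toQ γ) f) = dslash (toQ γ) (genAct g α f) := by
  rw [genAct_apply, genAct_apply, potential_mul_toQ, map_add, map_mul, map_mul, dslash_incl,
    dslash_toQ_symbol, dG2_dslash]

/-- The Leibniz rule for a single summand of $*^r$, with $x=F^1_\beta$ and
$y=F^2_{\alpha\beta^{-1}}$. -/
theorem genAct_mul (g : Gen) (α : GL(2, ℚ)⁺) (β : SL(2, ℤ)) (x y : QMTower) :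
    genAct g α (x * dslash (toQ β) y) = genAct g (toQ β) x * dslash (toQ β) y +
      x * dslash (toQ β) (genAct g (α * (toQ β)⁻¹) y) := by
  have h := genAct_mul_toQ g (α * (toQ β)⁻¹) β y
  rw [inv_mul_cancel_right] at h
  -- The first factor sits at $\beta\in SL_2(\mathbb Z)$, where the potential vanishes, so the whole
  -- potential at $\alpha$ goes to the second.
  rw [← h, genAct_apply, genAct_apply, genAct_apply, dG2_mul, potential_toQ, map_zero]
  ring

/-- The second order terms cancel. The potentials drop out because they are modular, hence killed by
$\partial$, and multiplication operators commute. -/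
theorem genAct_commutator (g h : Gen) (α : GL(2, ℚ)⁺) (f : QMTower) :
    genAct g α (genAct h α f) - genAct h α (genAct g α f) =
      (g.symbol * dG2 h.symbol - h.symbol * dG2 g.symbol) * dG2 f := by
  simp only [genAct_apply, map_add, dG2_mul, dG2_incl]
  ring

/-! ### Sums over cosets -/

section Cosets

variable {N : ℕ}

theorem toQ_mem_GammaQ {γ : SL(2, ℤ)} (hγ : γ ∈ Gamma N) : toQ γ ∈ GammaQ N := ⟨γ, hγ, rfl⟩

/-- $\Gamma(N)$ has finite index, so the `finsum` in `starR` is a genuine sum and never the default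
value 0. -/
instance finite_cosets [NeZero N] : Finite (Quotient (QuotientGroup.rightRel (Gamma N))) :=
  Finite.of_equiv _ (QuotientGroup.quotientRightRelEquivQuotientLeftRel (Gamma N)).symm

noncomputable instance fintype_cosets [NeZero N] :
    Fintype (Quotient (QuotientGroup.rightRel (Gamma N))) := Fintype.ofFinite _

/-- Right translation by $\delta$ permutes $\Gamma\backslash SL_2(\mathbb Z)$, and left invariance
makes the choice of representatives irrelevant. -/
theorem sum_cosets_mul_right [NeZero N] {A : Type*} [AddCommMonoid A] (φ : SL(2, ℤ) → A)
    (hφ : ∀ γ ∈ Gamma N, ∀ β, φ (γ * β) = φ β) (δ : SL(2, ℤ)) :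
    ∑ q : Quotient (QuotientGroup.rightRel (Gamma N)), φ (q.out * δ) =
      ∑ q : Quotient (QuotientGroup.rightRel (Gamma N)), φ q.out := by
  have hrel : ∀ (ε a b : SL(2, ℤ)), QuotientGroup.rightRel (Gamma N) a b →
      QuotientGroup.rightRel (Gamma N) (a * ε) (b * ε) := by
    intro ε a b h
    rw [QuotientGroup.rightRel_apply] at h ⊢
    simpa [mul_assoc] using h
  have hφ' : ∀ a b, QuotientGroup.rightRel (Gamma N) a b → φ a = φ b := by
    intro a b h
    rw [QuotientGroup.rightRel_apply] at h
    rw [← hφ _ h a, inv_mul_cancel_right]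
  let e : Quotient (QuotientGroup.rightRel (Gamma N)) ≃
      Quotient (QuotientGroup.rightRel (Gamma N)) :=
    { toFun := Quotient.map (· * δ) (hrel δ)
      invFun := Quotient.map (· * δ⁻¹) (hrel δ⁻¹)
      left_inv := by rintro ⟨a⟩; exact congrArg (Quotient.mk _) (mul_inv_cancel_right a δ)
      right_inv := by rintro ⟨a⟩; exact congrArg (Quotient.mk _) (inv_mul_cancel_right a δ) }
  refine Fintype.sum_equiv e _ _ fun q => hφ' _ _ (Quotient.exact ?_)
  rw [Quotient.out_eq]
  conv_rhs => rw [← Quotient.out_eq q]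
  rfl

theorem starR_eq_sum [NeZero N] (F G : GL(2, ℚ)⁺ → QMTower) (α : GL(2, ℚ)⁺) :
    starR N F G α = ∑ q : Quotient (QuotientGroup.rightRel (Gamma N)),
      F (toQ q.out) * dslash (toQ q.out) (G (α * (toQ q.out)⁻¹)) :=
  finsum_eq_sum_of_fintype _

theorem Q.left_inv (F : Q N) {γ : SL(2, ℤ)} (hγ : γ ∈ Gamma N) (α : GL(2, ℚ)⁺) :
    F.1 (toQ γ * α) = F.1 α := F.2.1 _ (toQ_mem_GammaQ hγ) α

theorem Q.right_equiv (F : Q N) {γ : SL(2, ℤ)} (hγ : γ ∈ Gamma N) (α : GL(2, ℚ)⁺) :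
    F.1 (α * toQ γ) = dslash (toQ γ) (F.1 α) := F.2.2.2 _ (toQ_mem_GammaQ hγ) α

/-- The second factor of a summand of $*^r$ depends only on the coset of $\beta$: the $\gamma^{-1}$
in the index is absorbed by $||\gamma$ through equivariance. -/
theorem Q.dslash_mul_inv (F : Q N) {γ : SL(2, ℤ)} (hγ : γ ∈ Gamma N) (α : GL(2, ℚ)⁺)
    (β : SL(2, ℤ)) : dslash (toQ (γ * β)) (F.1 (α * (toQ (γ * β))⁻¹)) =
      dslash (toQ β) (F.1 (α * (toQ β)⁻¹)) := by
  have h := Q.right_equiv F hγ (α * (toQ (γ * β))⁻¹)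
  rw [map_mul, dslash_mul, ← Q.right_equiv F hγ, mul_inv_rev, mul_assoc, inv_mul_cancel_right]

theorem finite_image_mul_right {S : Subgroup GL(2, ℚ)⁺} {s : Set GL(2, ℚ)⁺}
    (hs : (Quotient.mk (QuotientGroup.rightRel S) '' s).Finite) (β : GL(2, ℚ)⁺) :
    (Quotient.mk (QuotientGroup.rightRel S) '' ((· * β) '' s)).Finite := by
  have hrel : ∀ a b, QuotientGroup.rightRel S a b →
      QuotientGroup.rightRel S (a * β) (b * β) := by
    intro a b h
    rw [QuotientGroup.rightRel_apply] at h ⊢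
    simpa [mul_assoc] using h
  refine (hs.image (Quotient.map (· * β) hrel)).subset ?_
  rintro _ ⟨_, ⟨a, ha, rfl⟩, rfl⟩
  exact ⟨_, ⟨a, ha, rfl⟩, rfl⟩

/-! ### The algebra structure on $\mathcal Q(\Gamma)$ and its derivations. -/

theorem starR_mem [NeZero N] (F G : Q N) : starR N F.1 G.1 ∈ Q N := by
  refine ⟨?_, ?_, ?_⟩
  · rintro _ ⟨γ, hγ, rfl⟩ α
    simp only [starR_eq_sum, mul_assoc, Q.left_inv G hγ]
  -- A nonzero summand at $\beta$ puts $\alpha\beta^{-1}$ in the support of $G$, so the support of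
  -- the product lies in finitely many translates $\mathrm{supp}(G)\beta$.
  · refine (Set.finite_iUnion fun q : Quotient (QuotientGroup.rightRel (Gamma N)) =>
      finite_image_mul_right G.2.2.1 (toQ q.out)).subset ?_
    rintro _ ⟨α, hα, rfl⟩
    rw [Function.mem_support, starR_eq_sum] at hα
    obtain ⟨q, -, hq⟩ := Finset.exists_ne_zero_of_sum_ne_zero hα
    refine Set.mem_iUnion.mpr ⟨q, α, ⟨α * (toQ q.out)⁻¹, fun h => hq ?_, ?_⟩, rfl⟩
    · rw [h, map_zero, mul_zero]
    · exact inv_mul_cancel_right _ _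
  · rintro _ ⟨δ, hδ, rfl⟩ α
    simp only [starR_eq_sum, map_sum, map_mul]
    -- Replace $\beta$ by $\beta\delta$: then $F_{\beta\delta}=F_\beta||\delta$, and
    -- $\alpha\delta(\beta\delta)^{-1}=\alpha\beta^{-1}$.
    rw [← sum_cosets_mul_right (N := N) (fun β => F.1 (toQ β) *
      dslash (toQ β) (G.1 (α * toQ δ * (toQ β)⁻¹))) (fun γ hγ β => ?_) δ]
    · refine Finset.sum_congr rfl fun q _ => ?_
      rw [map_mul, Q.right_equiv F hδ, dslash_mul, mul_inv_rev, mul_assoc α, mul_inv_cancel_left]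
    · rw [Q.dslash_mul_inv G hγ, map_mul, Q.left_inv F hγ]

/-- The product of quasimodular Hecke operators as a bilinear map. -/
noncomputable def Q.mul [NeZero N] : Q N →ₗ[ℂ] Q N →ₗ[ℂ] Q N :=
  LinearMap.mk₂ ℂ (fun F G => ⟨starR N F.1 G.1, starR_mem F G⟩)
    (fun F F' G => Subtype.ext <| funext fun α => by
      change starR N (F.1 + F'.1) G.1 α = starR N F.1 G.1 α + starR N F'.1 G.1 α
      simp only [starR_eq_sum, Pi.add_apply, add_mul, Finset.sum_add_distrib])
    (fun c F G => Subtype.ext <| funext fun α => by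
      change starR N (c • F.1) G.1 α = c • starR N F.1 G.1 α
      simp only [starR_eq_sum, Pi.smul_apply, smul_mul_assoc, Finset.smul_sum])
    (fun F G G' => Subtype.ext <| funext fun α => by
      change starR N F.1 (G.1 + G'.1) α = starR N F.1 G.1 α + starR N F.1 G'.1 α
      simp only [starR_eq_sum, Pi.add_apply, map_add, mul_add, Finset.sum_add_distrib])
    (fun c F G => Subtype.ext <| funext fun α => by
      change starR N F.1 (c • G.1) α = c • starR N F.1 G.1 α
      simp only [starR_eq_sum, Pi.smul_apply, map_smul, mul_smul_comm, Finset.smul_sum])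

theorem Q.mul_apply [NeZero N] (F G : Q N) (α : GL(2, ℚ)⁺) :
    (Q.mul F G).1 α = starR N F.1 G.1 α := rfl

theorem Q.mul_assoc [NeZero N] (F G K : Q N) :
    Q.mul (Q.mul F G) K = Q.mul F (Q.mul G K) := by
  refine Subtype.ext (funext fun α => ?_)
  simp only [Q.mul_apply, starR_eq_sum, map_sum, map_mul, Finset.sum_mul, Finset.mul_sum]
  rw [Finset.sum_comm]
  refine Finset.sum_congr rfl fun r _ => ?_
  -- For fixed inner representative $r$, substituting $\beta r$ for $\beta$ turns the summand into
  -- $F_r\cdot\big((G_\beta\cdot(K_{\alpha r^{-1}\beta^{-1}}||\beta))||r\big)$.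
  rw [← sum_cosets_mul_right (N := N) (fun β => F.1 (toQ r.out) *
    dslash (toQ r.out) (G.1 (toQ β * (toQ r.out)⁻¹)) *
      dslash (toQ β) (K.1 (α * (toQ β)⁻¹))) (fun γ hγ β => ?_) r.out]
  · refine Finset.sum_congr rfl fun q _ => ?_
    rw [map_mul, mul_inv_cancel_right, dslash_mul, mul_inv_rev, _root_.mul_assoc,
      _root_.mul_assoc α]
  · rw [Q.dslash_mul_inv K hγ, map_mul, _root_.mul_assoc (toQ γ), Q.left_inv G hγ]

/-- The operator of a generator on quasimodular Hecke operators. -/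
noncomputable def genEnd (N : ℕ) (g : Gen) : Module.End ℂ (Q N) where
  toFun F := ⟨fun α => genAct g α (F.1 α), by
    refine ⟨?_, F.2.2.1.subset (Set.image_mono fun α hα h => hα ?_), ?_⟩
    · rintro _ ⟨γ, hγ, rfl⟩ α
      beta_reduce
      rw [genAct_toQ_mul, Q.left_inv F hγ]
    · change genAct g α (F.1 α) = 0
      rw [h, map_zero]
    · rintro _ ⟨γ, hγ, rfl⟩ α
      beta_reduce
      rw [Q.right_equiv F hγ, genAct_mul_toQ]⟩
  map_add' F G := Subtype.ext <| funext fun α => map_add (genAct g α) _ _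
  map_smul' c F := Subtype.ext <| funext fun α => map_smul (genAct g α) c _

theorem genEnd_apply (g : Gen) (F : Q N) (α : GL(2, ℚ)⁺) :
    (genEnd N g F).1 α = genAct g α (F.1 α) := rfl

theorem genEnd_mul [NeZero N] (g : Gen) (F G : Q N) :
    genEnd N g (Q.mul F G) = Q.mul (genEnd N g F) G + Q.mul F (genEnd N g G) := by
  refine Subtype.ext (funext fun α => ?_)
  change _ = starR N _ _ α + starR N _ _ α
  simp only [genEnd_apply, Q.mul_apply, starR_eq_sum, map_sum, genAct_mul,
    Finset.sum_add_distrib]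

end Cosets

/-! ### The action of the Hopf algebra -/

section Action

attribute [local instance 100] LieRing.ofAssociativeRing

theorem genEnd_commutator (N : ℕ) (g h : Gen) (F : Q N) (α : GL(2, ℚ)⁺) :
    (⁅genEnd N g, genEnd N h⁆ F).1 α =
      (g.symbol * dG2 h.symbol - h.symbol * dG2 g.symbol) * dG2 (F.1 α) :=
  genAct_commutator g h α (F.1 α)

/-- The action of the free Lie algebra on quasimodular Hecke operators. -/
noncomputable def freeAction (N : ℕ) : FreeLieAlgebra ℂ Gen →ₗ⁅ℂ⁆ Module.End ℂ (Q N) :=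
  FreeLieAlgebra.lift ℂ (genEnd N)

theorem freeAction_sym (N : ℕ) (g : Gen) : freeAction N g.sym = genEnd N g :=
  FreeLieAlgebra.lift_of_apply (genEnd N) g

/-! ### The commutator relations as identities between symbols. -/

theorem dG2_symbol_T (k : ℕ+) (l : ℕ) :
    dG2 (Gen.T k l).symbol = ((k : ℂ) - 1) • (incl G4 ^ l * G2 ^ ((k : ℕ) - 2)) := by
  rw [Gen.symbol, dG2_mul, ← map_pow, dG2_incl, zero_mul, zero_add, dG2_G2_pow, mul_smul_comm,
    Nat.cast_sub k.pos, Nat.cast_one]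
  rfl

theorem dG2_symbol_D : dG2 Gen.D.symbol = G2 := by
  rw [Gen.symbol, map_sub, map_smul, map_smul, dG2_G2_pow, dG2_incl, smul_zero, sub_zero,
    smul_smul]
  norm_num

/-- `hc` is needed at $k=0$: there `symT` is 0, while the truncated exponent $0-1=0$ would leave
$c\,G_4^l\,\partial$ on the right. -/
theorem freeAction_symT (N : ℕ) (k l : ℕ) (c : ℂ) (hc : k = 0 → c = 0) (F : Q N)
    (α : GL(2, ℚ)⁺) : (c • freeAction N (Gen.symT k l) F).1 α =
      c • (incl G4 ^ l * G2 ^ (k - 1) * dG2 (F.1 α)) := by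
  rcases Nat.eq_zero_or_pos k with rfl | hk
  · rw [hc rfl, zero_smul, zero_smul]; rfl
  · rw [Gen.symT, dif_pos hk, freeAction_sym]
    change c • genAct _ α (F.1 α) = _
    rw [genAct_apply]
    change c • (_ + incl 0 * _) = _
    rw [map_zero, zero_mul, add_zero]
    rfl

theorem symbol_T_mul_dG2_symbol_T (k k' : ℕ+) (l l' : ℕ) :
    (Gen.T k l).symbol * dG2 (Gen.T k' l').symbol =
      ((k' : ℂ) - 1) • (incl G4 ^ (l + l') * G2 ^ ((k : ℕ) + (k' : ℕ) - 2 - 1)) := by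
  rw [dG2_symbol_T, Gen.symbol]
  have hk := k.pos
  -- For $k'=1$ the truncated exponents on the two sides disagree, but the coefficient $k'-1$ is 0.
  rcases Nat.eq_or_lt_of_le k'.pos with h | h
  · simp [← h]
  · rw [show (k : ℕ) + (k' : ℕ) - 2 - 1 = ((k : ℕ) - 1) + ((k' : ℕ) - 2) by omega]
    algebra

theorem symbol_D_mul_dG2_symbol_T (k : ℕ+) (l : ℕ) :
    Gen.D.symbol * dG2 (Gen.T k l).symbol =
      (1 / 2 * ((k : ℂ) - 1)) • (incl G4 ^ l * G2 ^ (k : ℕ)) -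
        (5 / 24 * ((k : ℂ) - 1)) • (incl G4 ^ (l + 1) * G2 ^ ((k : ℕ) - 1 - 1)) := by
  rw [dG2_symbol_T, Gen.symbol]
  rcases Nat.eq_or_lt_of_le k.pos with h | h
  · simp [← h]
  · obtain ⟨n, hn⟩ : ∃ n, (k : ℕ) = n + 2 := ⟨(k : ℕ) - 2, by omega⟩
    rw [hn, show n + 2 - 2 = n by omega, show n + 2 - 1 - 1 = n by omega]
    algebra

theorem symbol_T_mul_dG2_symbol_D (k : ℕ+) (l : ℕ) :
    (Gen.T k l).symbol * dG2 Gen.D.symbol = incl G4 ^ l * G2 ^ (k : ℕ) := by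
  rw [dG2_symbol_D, Gen.symbol, mul_assoc, ← pow_succ, Nat.sub_add_cancel k.pos]

/-- With $x=G_2$ and $G_4$ constant, these are brackets of the fields $G_4^lx^{k-1}\partial_x$ and
$(\frac12x^2-\frac5{24}G_4)\partial_x$. Relations involving $\phi^{(m)}$ hold because its symbol is
0. -/
theorem freeAction_relator (N : ℕ) {x : FreeLieAlgebra ℂ Gen} (hx : Gen.Relator x) :
    freeAction N x = 0 := by
  refine LinearMap.ext fun F => Subtype.ext (funext fun α => ?_)
  cases hx with
  | TT k k' l l' =>
    -- The index $k+k'-2$ is 0 only for $k=k'=1$, where $k'-k$ vanishes.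
    have h := freeAction_symT N ((k : ℕ) + (k' : ℕ) - 2) (l + l') ((k' : ℂ) - (k : ℂ)) (fun h => by
      have h1 : (k : ℕ) = 1 := by have := k.pos; have := k'.pos; omega
      have h2 : (k' : ℕ) = 1 := by have := k.pos; have := k'.pos; omega
      rw [h1, h2, sub_self]) F α
    rw [map_sub, map_smul, LieHom.map_lie, freeAction_sym, freeAction_sym]
    refine (congrArg₂ (· - ·) (genEnd_commutator N _ _ F α) h).trans ?_
    change _ = (0 : QMTower)
    rw [symbol_T_mul_dG2_symbol_T, symbol_T_mul_dG2_symbol_T, add_comm (k' : ℕ), add_comm l']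
    algebra
  | Dφ m =>
    rw [LieHom.map_lie, freeAction_sym, freeAction_sym, genEnd_commutator]
    simp [Gen.symbol]
  | Tφ k l m =>
    rw [LieHom.map_lie, freeAction_sym, freeAction_sym, genEnd_commutator]
    simp [Gen.symbol]
  | φφ m m' =>
    rw [LieHom.map_lie, freeAction_sym, freeAction_sym, genEnd_commutator]
    simp [Gen.symbol]
  | TD k l =>
    have h1 := freeAction_symT N ((k : ℕ) - 1) (l + 1) (5 / 24 * ((k : ℂ) - 1)) (fun h => by
      have h1 : (k : ℕ) = 1 := by have := k.pos; omega
      rw [h1, Nat.cast_one, sub_self, mul_zero]) F α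
    have h2 := freeAction_symT N ((k : ℕ) + 1) l (1 / 2 * ((k : ℂ) - 3)) (fun h => by omega) F α
    rw [map_sub, map_sub, map_smul, map_smul, LieHom.map_lie,
      freeAction_sym, freeAction_sym]
    refine (congrArg₂ (· - ·) (genEnd_commutator N _ _ F α) (congrArg₂ (· - ·) h1 h2)).trans ?_
    change _ = (0 : QMTower)
    rw [symbol_T_mul_dG2_symbol_D, symbol_D_mul_dG2_symbol_T, Nat.add_sub_cancel]
    algebra

theorem relators_le_ker (N : ℕ) :
    LieSubmodule.lieSpan ℂ (FreeLieAlgebra ℂ Gen) {x : FreeLieAlgebra ℂ Gen | Gen.Relator x} ≤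
      (freeAction N).ker :=
  LieSubmodule.lieSpan_le.mpr fun _ hx => LieHom.mem_ker.mpr (freeAction_relator N hx)

/-- The action of the Lie algebra on quasimodular Hecke operators, as a linear map. -/
noncomputable def lieActionLin (N : ℕ) : L →ₗ[ℂ] Module.End ℂ (Q N) :=
  Submodule.liftQ _ (freeAction N).toLinearMap fun _ hx => LieHom.mem_ker.mp (relators_le_ker N hx)

/-- The action of the Lie algebra on quasimodular Hecke operators. -/
noncomputable def lieAction (N : ℕ) : L →ₗ⁅ℂ⁆ Module.End ℂ (Q N) where
  toLinearMap := lieActionLin N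
  map_lie' {x y} := by
    obtain ⟨x, rfl⟩ := LieSubmodule.Quotient.surjective_mk' _ x
    obtain ⟨y, rfl⟩ := LieSubmodule.Quotient.surjective_mk' _ y
    exact LieHom.map_lie (freeAction N) x y

/-- The action of the Hopf algebra on quasimodular Hecke operators. -/
noncomputable def hopfAction (N : ℕ) : H →ₐ[ℂ] Module.End ℂ (Q N) :=
  UniversalEnvelopingAlgebra.lift ℂ (lieAction N)

theorem hopfAction_toH (N : ℕ) (g : Gen) : hopfAction N g.toH = genEnd N g := by
  refine (UniversalEnvelopingAlgebra.lift_ι_apply ℂ (lieAction N) _).trans ?_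
  exact freeAction_sym N g

/-! ### From the Leibniz rule on generators to the Hopf action. -/

/-- Induction on generators: the lift into $S$ followed by the inclusion fixes the generators, hence
is the identity. -/
theorem freeLieAlgebra_mem {X : Type*} {S : LieSubalgebra ℂ (FreeLieAlgebra ℂ X)}
    (hS : ∀ i, FreeLieAlgebra.of ℂ i ∈ S) (x : FreeLieAlgebra ℂ X) : x ∈ S := by
  let f : FreeLieAlgebra ℂ X →ₗ⁅ℂ⁆ S := FreeLieAlgebra.lift ℂ fun i => ⟨_, hS i⟩
  have h : S.incl.comp f = LieHom.id := FreeLieAlgebra.hom_ext fun i =>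
    congrArg Subtype.val (FreeLieAlgebra.lift_of_apply (fun i => (⟨_, hS i⟩ : S)) i)
  have hx : ((f x : S) : FreeLieAlgebra ℂ X) = x := LieHom.congr_fun h x
  exact hx ▸ (f x).2

variable {N : ℕ} [NeZero N]

/-- The elements acting by derivations form a Lie subalgebra, and it contains the generators by
`genEnd_mul`. -/
theorem freeAction_mul (x : FreeLieAlgebra ℂ Gen) (F G : Q N) : freeAction N x (Q.mul F G) =
    Q.mul (freeAction N x F) G + Q.mul F (freeAction N x G) := by
  refine freeLieAlgebra_mem (S :=
    { carrier := {x | ∀ F G : Q N, freeAction N x (Q.mul F G) =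
        Q.mul (freeAction N x F) G + Q.mul F (freeAction N x G)}
      add_mem' := fun {x y} hx hy F G => ?_
      zero_mem' := fun F G => ?_
      smul_mem' := fun c x hx F G => ?_
      lie_mem' := fun {x y} hx hy F G => ?_ }) (fun g F G => ?_) x F G
  · simp only [map_add, LinearMap.add_apply, hx F G, hy F G]
    abel
  · simp only [map_zero, LinearMap.zero_apply, add_zero]
  · simp only [map_smul, LinearMap.smul_apply, hx F G, smul_add]
  -- In $xy-yx$ the mixed terms $xF*yG$ and $yF*xG$ cancel.
  · simp only [LieHom.map_lie, LieRing.of_associative_ring_bracket, LinearMap.sub_apply,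
      Module.End.mul_apply, map_add, map_sub, hx F G, hy F G, hx (freeAction N y F) G,
      hx F (freeAction N y G), hy (freeAction N x F) G, hy F (freeAction N x G)]
    abel
  · exact (freeAction_sym N g).symm ▸ genEnd_mul g F G

theorem hopfAction_ι_mul (x : L) (F G : Q N) :
    hopfAction N (UniversalEnvelopingAlgebra.ι ℂ x) (Q.mul F G) =
      Q.mul (hopfAction N (UniversalEnvelopingAlgebra.ι ℂ x) F) G +
        Q.mul F (hopfAction N (UniversalEnvelopingAlgebra.ι ℂ x) G) := by
  obtain ⟨x⟩ := x
  have h : hopfAction N (UniversalEnvelopingAlgebra.ι ℂ (Quot.mk _ x : L)) = freeAction N x :=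
    UniversalEnvelopingAlgebra.lift_ι_apply ℂ (lieAction N) _
  rw [h]
  exact freeAction_mul x F G

/-- The action of a tensor on a product of two quasimodular Hecke operators, factor by factor. -/
noncomputable def tensorAction (F G : Q N) : H ⊗[ℂ] H →ₗ[ℂ] Q N :=
  TensorProduct.lift ((Q.mul (N := N)).compl₁₂ ((hopfAction N).toLinearMap.flip F)
    ((hopfAction N).toLinearMap.flip G))

theorem tensorAction_tmul (F G : Q N) (a b : H) :
    tensorAction F G (a ⊗ₜ b) = Q.mul (hopfAction N a F) (hopfAction N b G) := rfl

/-- Only $t=1\otimes1$ is used afterwards. A general $t$ lets the induction pass through a product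
$ab$: first $b$ is applied to $t$, then $a$ to $\Delta(b)t$. -/
theorem hopfAction_tensorAction (h : H) (t : H ⊗[ℂ] H) (F G : Q N) :
    hopfAction N h (tensorAction F G t) = tensorAction F G (envComul L h * t) := by
  induction h using env_induction L generalizing t with
  | hι x =>
    rw [envComul_ι]
    induction t using TensorProduct.induction_on with
    | zero => simp
    | tmul a b =>
      simp only [add_mul, Algebra.TensorProduct.tmul_mul_tmul, one_mul, map_add,
        tensorAction_tmul, hopfAction_ι_mul, map_mul, Module.End.mul_apply]
    | add a b ha hb => rw [mul_add, map_add, map_add, map_add, ha, hb]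
  | hc c => simp [Algebra.algebraMap_eq_smul_one]
  | hadd a b ha hb => simp only [map_add, LinearMap.add_apply, add_mul, ha, hb]
  | hmul a b ha hb =>
    rw [map_mul, Module.End.mul_apply, hb, ha, map_mul (envComul L), _root_.mul_assoc]

theorem hopfAction_mul (h : H) (F G : Q N) :
    hopfAction N h (Q.mul F G) = tensorAction F G (Coalgebra.comul (R := ℂ) h) := by
  have := hopfAction_tensorAction h 1 F G
  rw [mul_one, Algebra.TensorProduct.one_def, tensorAction_tmul, map_one] at this
  exact this

end Action

end QuasimodularHecke

open QuasimodularHecke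
open scoped MatrixGroups TensorProduct
theorem mainTheorem2 (N : ℕ) (hN : N ≠ 0) :
    ∃ (mul : Q N →ₗ[ℂ] Q N →ₗ[ℂ] Q N)
      (ρ : H →ₐ[ℂ] Module.End ℂ (Q N)),
      (∀ (F G : Q N) (α : GL(2, ℚ)⁺),
        (mul F G).1 α = starR N F.1 G.1 α) ∧
      (∀ F G K : Q N, mul (mul F G) K = mul F (mul G K)) ∧
      (∀ (F : Q N) (α : GL(2, ℚ)⁺),
        (ρ Gen.D.toH F).1 α = opD (F.1 α)) ∧
      (∀ (k : ℕ+) (l : ℕ) (F : Q N) (α : GL(2, ℚ)⁺),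
        (ρ (Gen.T k l).toH F).1 α = opT k l (F.1 α)) ∧
      (∀ (m : ℕ+) (F : Q N) (α : GL(2, ℚ)⁺),
        (ρ (Gen.φ m).toH F).1 α =
          incl (nu m α) * F.1 α) ∧
      ∀ (h : H) (F G : Q N) (ι : Type)
        (r : Coalgebra.Repr ℂ h ι),
        ρ h (mul F G) = ∑ i ∈ r.index, mul (ρ (r.left i) F) (ρ (r.right i) G) := by
  have : NeZero N := ⟨hN⟩
  refine ⟨Q.mul, hopfAction N, Q.mul_apply, Q.mul_assoc, fun F α => ?_, fun k l F α => ?_,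
    fun m F α => ?_, fun h F G ι r => ?_⟩
  · rw [hopfAction_toH, genEnd_apply, genAct_apply, opD_eq]
    change _ + incl 0 * _ = _
    rw [map_zero, zero_mul, add_zero]
  · rw [hopfAction_toH, genEnd_apply, genAct_apply, opT_eq]
    change _ + incl 0 * _ = _
    rw [map_zero, zero_mul, add_zero]
  · rw [hopfAction_toH, genEnd_apply, genAct_apply]
    change 0 * _ + incl (nu m α) * _ = _
    rw [zero_mul, zero_add]
  -- A Sweedler representation `r` is exactly an expression of $\Delta(h)$ as a sum of pure tensors.
  · rw [hopfAction_mul, ← r.eq, map_sum]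
    rfl
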